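/- Let $\mathbb K$ be $\mathbb R$ or $\mathbb C$; all Banach spaces are over $\mathbb K$. For a Banach space $X$ write $B_X$ for its closed unit ball and $S_X$ for its unit sphere. A *slice* of $B_X$ is a set $\{x\in B_X:\operatorname{Re} f(x)>\sup\operatorname{Re} f(B_X)-\alpha\}$ with $f\in X^*$, $\alpha>0$. $X$ has the *slice-D2P* if every slice of $B_X$ has diameter exactly $2$, and the *Daugavet property* if for every slice $S$ of $B_X$, every $x\in S_X$ and every $\varepsilon>0$ there is $y\in S$ with $\|x-y\|>2-\varepsilon$. For $n\in\mathbb N$, $n\ge1$, and $\alpha>0$ let $$S^\alpha(X)=\Big\{\tfrac{x+y}{2}:x,y\in B_X,\ \|x-y\|\ge\alpha\Big\},\qquad C_n^\alpha(X)=\sup_{x\in S_X} d\big(x,\operatorname{conv}_n S^\alpha(X)\big),$$ where $\operatorname{conv}_n(C)$ is the set of convex combinations of at most $n$ elements of $C$ and $d(x,\emptyset)=\infty$. For a free ultrafilter $\mathcal U$ on $\mathbb N$, the ultrapower is $(X)_{\mathcal U}=\ell_\infty(\mathbb N,X)/\{(x_n):\lim_{\mathcal U}\|x_n\|=0\}$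 with the quotient norm. **Theorem.** (a) For every $\eta>0$ there are Banach spaces $X_1,X_2,\dots$ such that, with $\theta=\eta/4$: - every $X_n$ has the Daugavet property; - there is $c>0$ with $C_n^{2\theta}(X_n)\ge c$ for all $n\ge 1$, and if $\mathbb K=\mathbb R$ then moreover $C_n^{2\theta}(X_n)\ge\theta/8$ for all $n\ge1$; - the $\ell_1$-sum $X=\big(\bigoplus_{n=1}^\infty X_n\big)_1$ is a nonzero Banach space with the Daugavet property such that, for every free ultrafilter $\mathcal U$ on $\mathbb N$, the unit ball of $(X)_{\mathcal U}$ has a slice of diameter at most $\eta$. (b) In particular, the slice-D2P does not pass to ultrapowers: there is a Banach space $X$ with the slice-D2P such that $(X)_{\mathcal U}$ fails the slice-D2P for every free ultrafilter $\mathcal U$ on $\mathbb N$. -/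

import Mathlib

open Filter Topology
open scoped ENNReal

universe u

noncomputable section

/-! ### Slices, the slice diameter two property, the Daugavet property -/

section Slices

variable (𝕜 : Type*) [RCLike 𝕜] (X : Type*) [NormedAddCommGroup X] [NormedSpace 𝕜 X]

variable {𝕜 X} in
/-- `S(C, f, α) = {x ∈ C : Re f(x) > sup Re f(C) - α}`. -/
def slice (C : Set X) (f : StrongDual 𝕜 X) (α : ℝ) : Set X :=
  {x | x ∈ C ∧ sSup ((fun y => RCLike.re (f y)) '' C) - α < RCLike.re (f x)}

/-- `S` is a slice of the closed unit ball of `X`. -/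
def IsSliceOfUnitBall (S : Set X) : Prop :=
  ∃ (f : StrongDual 𝕜 X) (α : ℝ), 0 < α ∧ S = slice (Metric.closedBall (0 : X) 1) f α

/-- Every slice of the closed unit ball has diameter exactly two. -/
def HasSliceD2P : Prop :=
  ∀ S : Set X, IsSliceOfUnitBall 𝕜 X S → Metric.diam S = 2

/-- For every slice `S` of the unit ball, every unit vector `x` and every `ε > 0` there is `y ∈ S`
with `‖x - y‖ > 2 - ε`. -/
def HasDaugavetProperty : Prop :=
  ∀ S : Set X, IsSliceOfUnitBall 𝕜 X S → ∀ x ∈ Metric.sphere (0 : X) 1, ∀ ε : ℝ, 0 < ε →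
    ∃ y ∈ S, 2 - ε < ‖x - y‖

end Slices

/-! ### The quantities `C_n^α(X)` -/

section Convexity

variable (𝕜 : Type*) [RCLike 𝕜] (X : Type*) [NormedAddCommGroup X] [NormedSpace 𝕜 X]

variable {X} in
/-- The convex combinations (with real weights) of `n` elements of `C`, repetitions allowed. -/
def convN (n : ℕ) (C : Set X) : Set X :=
  {z | ∃ (w : Fin n → ℝ) (x : Fin n → X),
    (∀ i, w i ∈ Set.Icc (0 : ℝ) 1) ∧ ∑ i, w i = 1 ∧ (∀ i, x i ∈ C) ∧
      z = ∑ i, ((w i : ℝ) : 𝕜) • x i}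

/-- `S^α(X)`: the midpoints of pairs of points of the unit ball at distance at least `α`. -/
def farMidpoints (α : ℝ) : Set X :=
  {z | ∃ x ∈ Metric.closedBall (0 : X) 1, ∃ y ∈ Metric.closedBall (0 : X) 1,
    α ≤ ‖x - y‖ ∧ z = (2⁻¹ : 𝕜) • (x + y)}

/-- `C_n^α(X) = sup_{x ∈ S_X} d(x, conv_n S^α(X))`, with the convention `d(x, ∅) = ∞`. -/
def uniformConst (n : ℕ) (α : ℝ) : ℝ≥0∞ :=
  ⨆ x ∈ Metric.sphere (0 : X) 1, Metric.infEDist x (convN 𝕜 n (farMidpoints 𝕜 X α))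

end Convexity

/-! ### Ultraproducts of Banach spaces -/

section Ultraproducts

variable (𝕜 : Type*) [RCLike 𝕜] (U : Ultrafilter ℕ)
  (X : ℕ → Type*) [∀ n, NormedAddCommGroup (X n)] [∀ n, NormedSpace 𝕜 (X n)]

/-- An ultrafilter on `ℕ` is free if it contains all cofinite sets. -/
def IsFreeUltrafilter (U : Ultrafilter ℕ) : Prop := (U : Filter ℕ) ≤ cofinite

/-- `c_{0,U}(ℕ, X_n)`: the bounded sequences whose norms tend to `0` along `U`. -/
def c0Ultra : Submodule 𝕜 (lp X ∞) where
  carrier := {f | Tendsto (fun n => ‖f n‖) (U : Filter ℕ) (𝓝 0)}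
  zero_mem' := by simp
  add_mem' := by
    intro f g hf hg
    have h : Tendsto (fun n => ‖f n‖ + ‖g n‖) (U : Filter ℕ) (𝓝 (0 + 0)) := Tendsto.add hf hg
    rw [add_zero] at h
    exact squeeze_zero (fun n => norm_nonneg _) (fun n => norm_add_le (f n) (g n)) h
  smul_mem' := by
    intro c f hf
    have h : Tendsto (fun n => ‖c‖ * ‖f n‖) (U : Filter ℕ) (𝓝 (‖c‖ * 0)) :=
      Tendsto.const_mul _ hf
    simpa [norm_smul] using h

instance c0Ultra_isClosed : IsClosed (c0Ultra 𝕜 U X : Set (lp X ∞)) := by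
  rw [← isSeqClosed_iff_isClosed]
  intro f g hf hfg
  change Tendsto (fun n => ‖g n‖) (U : Filter ℕ) (𝓝 0)
  rw [Metric.tendsto_nhds]
  intro ε hε
  obtain ⟨k, hk⟩ := ((Metric.tendsto_nhds.1 hfg) (ε / 2) (half_pos hε)).exists
  have hk' : Tendsto (fun n => ‖f k n‖) (U : Filter ℕ) (𝓝 0) := hf k
  filter_upwards [(Metric.tendsto_nhds.1 hk') (ε / 2) (half_pos hε)] with n hn
  have h1 : ‖(f k - g) n‖ ≤ ‖f k - g‖ := lp.norm_apply_le_norm (by simp) _ n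
  rw [dist_eq_norm] at hk
  simp only [dist_zero_right, norm_norm] at hn ⊢
  have h2 : ‖g n‖ ≤ ‖f k n‖ + ‖(f k - g) n‖ := by
    have := norm_sub_le (f k n) ((f k - g) n)
    simpa using this
  linarith

/-- The ultraproduct `(X_n)_U = ℓ_∞(ℕ, X_n) / c_{0,U}(ℕ, X_n)` with the quotient norm. -/
abbrev BanachUltraproduct : Type _ := lp X ∞ ⧸ c0Ultra 𝕜 U X

/-- The ultrapower `(X)_U`. -/
abbrev BanachUltrapower (X : Type*) [NormedAddCommGroup X] [NormedSpace 𝕜 X] : Type _ :=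
  BanachUltraproduct 𝕜 U (fun _ : ℕ => X)

end Ultraproducts

end

noncomputable section

/-! ### Slowly varying weights -/

/-! For each `m`, `TreeSpace 𝕜 m` is a quotient of `ℓ¹` generated by atoms of norm at most one,
indexed by a tree in which every node has infinitely many groups of infinitely many children. The
only relations say that, for a finite set `A` of siblings under `t`, the sum of the differences
`child - t` over `A`, divided by `2 W(|A|)`, is again an atom. Here `W` is the partial sum of the
weights `(r + 1) ^ (-1 / m)`, which meet two opposing demands.

Since `W(k) = o(k)`, averages of `k` siblings tend to their parent. So a slice containing a
unimodular multiple of an atom contains the same multiple of some child in a fresh group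
(`exists_child_re_gt`), and such a child is in `ℓ¹` position to any given finite combination of
older atoms (`norm_sub_smul_atom_child`). This is the Daugavet property.

Yet the weights decay so slowly that `m` different rankings of a sibling group have, up to a factor
two, a common majorant with partial sums below `W` (`exists_common_weight`). Killing rates with such
partial sums define survival probabilities `S` for which `2S - 1` is a functional of norm at most
one with value `1` at the root. For at most `m` points of the ball the rates can be chosen so that
the mass killed bounds each point's displacement from the root (`exists_rate`). If a convex
combination is close to the root, little mass is killed, so the points are close to the root on
average: the root is stable, with constants independent of `m` (`sum_mul_norm_sub_atom_root_le`).

A convex combination of `n` midpoints is one of `2n` points, so stability bounds `C_n` below. In the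
`ℓ¹`-sum, which keeps the Daugavet property, the roots for growing `m` form a point of the
ultrapower stable under all finite convex combinations; Hahn-Banach separates it from the midpoints
of far pairs and yields a small slice. -/

/-- The slowly decreasing weight sequence `(r + 1) ^ (-1 / m)`. -/
def slowWeight (m r : ℕ) : ℝ := ((r : ℝ) + 1) ^ (-(1 / (m : ℝ)))

/-- Partial sums of `slowWeight`. -/
def slowSum (m k : ℕ) : ℝ := ∑ r ∈ Finset.range k, slowWeight m r

theorem slowWeight_pos (m r : ℕ) : 0 < slowWeight m r :=
  Real.rpow_pos_of_pos (by positivity) _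

theorem slowWeight_zero (m : ℕ) : slowWeight m 0 = 1 := by simp [slowWeight]

theorem slowWeight_antitone (m : ℕ) : Antitone (slowWeight m) := by
  intro a b hab
  refine Real.rpow_le_rpow_of_nonpos (by positivity) ?_ ?_
  · have : (a : ℝ) ≤ b := by exact_mod_cast hab
    linarith
  · have : 0 ≤ 1 / (m : ℝ) := by positivity
    linarith

theorem slowWeight_le_one (m r : ℕ) : slowWeight m r ≤ 1 := by
  rw [← slowWeight_zero m]
  exact slowWeight_antitone m (Nat.zero_le r)

/-- Stretching the index by `m` costs a factor `m ^ (-1 / m)`, at least `1 / 2` because `m ≤ 2 ^ m`.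
This is why the exponent is `1 / m`: it lets `m` copies of the weights be interleaved. -/
theorem half_slowWeight_le {m : ℕ} (r : ℕ) {l : ℕ} (hl : l < m) :
    slowWeight m r / 2 ≤ slowWeight m (m * r + l) := by
  have hm : 0 < m := by omega
  have hm' : (0 : ℝ) < m := by exact_mod_cast hm
  have h1 : slowWeight m (m * (r + 1) - 1) ≤ slowWeight m (m * r + l) := by
    apply slowWeight_antitone
    rw [Nat.mul_add]
    omega
  refine le_trans ?_ h1
  have h2 : ((m * (r + 1) - 1 : ℕ) : ℝ) + 1 = m * ((r : ℝ) + 1) := by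
    have : 1 ≤ m * (r + 1) := Nat.mul_pos hm (Nat.succ_pos r)
    push_cast [Nat.cast_sub this]
    ring
  rw [slowWeight, slowWeight, h2, Real.mul_rpow hm'.le (by positivity), mul_comm (_ ^ _) (_ ^ _),
    div_eq_mul_inv]
  refine mul_le_mul_of_nonneg_left ?_ (slowWeight_pos m r).le
  rw [Real.rpow_neg hm'.le]
  refine inv_anti₀ (by positivity) ?_
  have h3 : (m : ℝ) ≤ 2 ^ m := by exact_mod_cast (Nat.lt_two_pow_self).le
  calc (m : ℝ) ^ (1 / (m : ℝ)) ≤ ((2 : ℝ) ^ m) ^ (1 / (m : ℝ)) :=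
        Real.rpow_le_rpow hm'.le h3 (by positivity)
    _ = 2 := by
        rw [one_div]
        exact Real.pow_rpow_inv_natCast (by norm_num) hm.ne'

theorem slowSum_zero (m : ℕ) : slowSum m 0 = 0 := by simp [slowSum]

theorem slowSum_nonneg (m k : ℕ) : 0 ≤ slowSum m k :=
  Finset.sum_nonneg fun r _ => (slowWeight_pos m r).le

theorem one_le_slowSum (m : ℕ) {k : ℕ} (hk : 0 < k) : 1 ≤ slowSum m k := by
  rw [← slowWeight_zero m]
  exact Finset.single_le_sum (f := slowWeight m) (fun r _ => (slowWeight_pos m r).le)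
    (Finset.mem_range.2 hk)

theorem exists_slowSum_le {m : ℕ} (hm : 0 < m) {ε : ℝ} (hε : 0 < ε) :
    ∃ k : ℕ, 0 < k ∧ slowSum m k ≤ ε * k := by
  have h0 : Tendsto (slowWeight m) atTop (𝓝 0) := by
    have h1 : Tendsto (fun x : ℝ => x ^ (-(1 / (m : ℝ)))) atTop (𝓝 0) :=
      tendsto_rpow_neg_atTop (by positivity)
    exact h1.comp (tendsto_atTop_add_const_right _ _ tendsto_natCast_atTop_atTop)
  obtain ⟨k, hk, hk0⟩ := ((h0.cesaro.eventually_lt_const hε).and (eventually_gt_atTop 0)).exists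
  refine ⟨k, hk0, ?_⟩
  have hk' : (0 : ℝ) < k := by exact_mod_cast hk0
  rw [inv_mul_lt_iff₀ hk'] at hk
  rw [slowSum, mul_comm]
  exact hk.le

theorem sum_slowWeight_le (m : ℕ) (s : Finset ℕ) : ∑ r ∈ s, slowWeight m r ≤ slowSum m s.card := by
  induction s using Finset.induction_on_max with
  | empty => simp [slowSum]
  | insert a s ha ih =>
    have hmem : a ∉ s := fun h => lt_irrefl _ (ha a h)
    have hcard : s.card ≤ a := by
      have : s ⊆ Finset.range a := fun x hx => Finset.mem_range.2 (ha x hx)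
      simpa using Finset.card_le_card this
    rw [Finset.sum_insert hmem, Finset.card_insert_of_notMem hmem, slowSum, Finset.sum_range_succ,
      add_comm]
    exact add_le_add ih (slowWeight_antitone m hcard)

theorem sum_slowWeight_comp_le (m : ℕ) {A : Finset ℕ} {σ : ℕ → ℕ} (hσ : Set.InjOn σ A) :
    ∑ i ∈ A, slowWeight m (σ i) ≤ slowSum m A.card := by
  classical
  rw [← Finset.sum_image (f := slowWeight m) (g := σ) (s := A) hσ, ← Finset.card_image_of_injOn hσ]
  exact sum_slowWeight_le m _

/-- Abel summation: a nonnegative sequence is ranked so that every family with controlled partial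
sums is dominated by the weights of the ranks. -/
theorem exists_rank (𝕜 : Type u) [RCLike 𝕜] (m : ℕ) (I : Finset ℕ) :
    ∀ β : ℕ → ℝ, (∀ i ∈ I, 0 ≤ β i) →
      ∃ τ : ℕ → ℕ, Set.InjOn τ I ∧ (∀ i ∈ I, τ i < I.card) ∧
        ∀ h : ℕ → 𝕜, (∀ A : Finset ℕ, ‖∑ i ∈ A, h i‖ ≤ 2 * slowSum m A.card) →
          ‖∑ i ∈ I, (β i : 𝕜) * h i‖ ≤ 2 * ∑ i ∈ I, β i * slowWeight m (τ i) := by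
  classical
  induction I using Finset.strongInduction with
  | H I ih =>
    intro β hβ
    rcases I.eq_empty_or_nonempty with rfl | hI
    · exact ⟨id, by simp, by simp, by simp⟩
    -- The smallest coefficient receives the last rank. Subtracting it from all coefficients leaves
    -- a nonnegative family on the other indices, and the constant part is controlled by the partial
    -- sum over all of `I`.
    obtain ⟨i₀, hi₀, hmin⟩ := I.exists_min_image β hI
    obtain ⟨τ, hinj, hlt, hτ⟩ := ih (I.erase i₀) (Finset.erase_ssubset hi₀)
      (fun i => β i - β i₀) (fun i hi => sub_nonneg.2 (hmin i (Finset.mem_of_mem_erase hi)))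
    have hcard : (I.erase i₀).card + 1 = I.card := Finset.card_erase_add_one hi₀
    have hne : ∀ i ∈ I.erase i₀, Function.update τ i₀ (I.erase i₀).card i = τ i := fun i hi =>
      Function.update_of_ne (Finset.ne_of_mem_erase hi) _ _
    have hself : Function.update τ i₀ (I.erase i₀).card i₀ = (I.erase i₀).card :=
      Function.update_self _ _ _
    set τ' := Function.update τ i₀ (I.erase i₀).card with hτ'
    have hinj' : Set.InjOn τ' I := by
      intro i hi j hj hij
      by_cases h1 : i = i₀ <;> by_cases h2 : j = i₀
      · rw [h1, h2]
      · have hj' : j ∈ I.erase i₀ := Finset.mem_erase.2 ⟨h2, hj⟩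
        rw [h1, hself, hne j hj'] at hij
        exact absurd (hlt j hj') (by omega)
      · have hi' : i ∈ I.erase i₀ := Finset.mem_erase.2 ⟨h1, hi⟩
        rw [h2, hself, hne i hi'] at hij
        exact absurd (hlt i hi') (by omega)
      · have hi' : i ∈ I.erase i₀ := Finset.mem_erase.2 ⟨h1, hi⟩
        have hj' : j ∈ I.erase i₀ := Finset.mem_erase.2 ⟨h2, hj⟩
        rw [hne i hi', hne j hj'] at hij
        exact hinj hi' hj' hij
    have hlt' : ∀ i ∈ I, τ' i < I.card := by
      intro i hi
      by_cases h1 : i = i₀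
      · rw [h1, hself]; omega
      · have hi' : i ∈ I.erase i₀ := Finset.mem_erase.2 ⟨h1, hi⟩
        rw [hne i hi']
        exact (hlt i hi').trans (by omega)
    refine ⟨τ', hinj', hlt', fun h hh => ?_⟩
    have h1 : ∑ i ∈ I, (β i : 𝕜) * h i =
        (β i₀ : 𝕜) * ∑ i ∈ I, h i + ∑ i ∈ I.erase i₀, ((β i - β i₀ : ℝ) : 𝕜) * h i := by
      rw [← Finset.add_sum_erase I h hi₀, ← Finset.add_sum_erase I _ hi₀, mul_add, add_assoc,
        Finset.mul_sum, ← Finset.sum_add_distrib]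
      congr 1
      refine Finset.sum_congr rfl fun i _ => ?_
      push_cast
      ring
    have hsum : slowSum m I.card = ∑ i ∈ I, slowWeight m (τ' i) := by
      have himg : I.image τ' = Finset.range I.card := by
        refine Finset.eq_of_subset_of_card_le ?_ ?_
        · intro r hr
          obtain ⟨i, hi, rfl⟩ := Finset.mem_image.1 hr
          exact Finset.mem_range.2 (hlt' i hi)
        · rw [Finset.card_range, Finset.card_image_of_injOn hinj']
      rw [slowSum, ← himg, Finset.sum_image hinj']
    have h2 : ∑ i ∈ I, β i * slowWeight m (τ' i) = β i₀ * slowSum m I.card +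
        ∑ i ∈ I.erase i₀, (β i - β i₀) * slowWeight m (τ i) := by
      rw [hsum, ← Finset.add_sum_erase I _ hi₀,
        ← Finset.add_sum_erase I (fun i => slowWeight m (τ' i)) hi₀, mul_add, add_assoc,
        Finset.mul_sum, ← Finset.sum_add_distrib]
      congr 1
      refine Finset.sum_congr rfl fun i hi => ?_
      rw [hne i hi]
      ring
    rw [h1, h2]
    have h3 : ‖(β i₀ : 𝕜) * ∑ i ∈ I, h i‖ ≤ β i₀ * (2 * slowSum m I.card) := by
      rw [norm_mul, RCLike.norm_ofReal, abs_of_nonneg (hβ i₀ hi₀)]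
      exact mul_le_mul_of_nonneg_left (hh I) (hβ i₀ hi₀)
    have h4 := hτ h hh
    have h5 := norm_add_le ((β i₀ : 𝕜) * ∑ i ∈ I, h i)
      (∑ i ∈ I.erase i₀, ((β i - β i₀ : ℝ) : 𝕜) * h i)
    linarith

/-- Up to the factor two, the weights of `card ι ≤ m` rankings are dominated by a single family
with controlled partial sums. -/
theorem exists_common_weight (𝕜 : Type u) [RCLike 𝕜] {m : ℕ} {ι : Type*} [Fintype ι]
    (hι : Fintype.card ι ≤ m) (I : Finset ℕ) (β : ι → ℕ → ℝ) (hβ : ∀ l, ∀ i ∈ I, 0 ≤ β l i) :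
    ∃ v : ℕ → ℝ, (∀ i, 0 ≤ v i) ∧ (∀ i, v i ≤ 1) ∧
      (∀ A : Finset ℕ, ∑ i ∈ A, v i ≤ slowSum m A.card) ∧
      ∀ l, ∀ h : ℕ → 𝕜, (∀ A : Finset ℕ, ‖∑ i ∈ A, h i‖ ≤ 2 * slowSum m A.card) →
        ‖∑ i ∈ I, (β l i : 𝕜) * h i‖ ≤ 4 * ∑ i ∈ I, β l i * v i := by
  classical
  rcases isEmpty_or_nonempty ι with hemp | hne
  · exact ⟨0, by simp, by simp, fun A => by simpa using slowSum_nonneg m _, fun l => hemp.elim l⟩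
  choose τ hinj _ hτ using fun l => exists_rank 𝕜 m I (β l) (hβ l)
  -- `L i` is the ranking that gives `i` its largest weight.
  choose L hL using fun i : ℕ => Finite.exists_max fun l => slowWeight m (τ l i)
  let e : ι → ℕ := fun l => Fintype.equivFin ι l
  have he : ∀ l, e l < m := fun l => (Fintype.equivFin ι l).2.trans_le hι
  have he_inj : Function.Injective e := Fin.val_injective.comp (Fintype.equivFin ι).injective
  refine ⟨fun i => if i ∈ I then slowWeight m (τ (L i) i) / 2 else 0, fun i => ?_, fun i => ?_,
    fun A => ?_, fun l h hh => ?_⟩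
  · dsimp only
    split_ifs
    · exact (half_pos (slowWeight_pos _ _)).le
    · exact le_rfl
  · dsimp only
    split_ifs
    · linarith [slowWeight_le_one m (τ (L i) i)]
    · exact zero_le_one
  · rw [← Finset.sum_filter]
    -- The index `m * rank + label` encodes rank and ranking in base `m`, and each ranking is
    -- injective; distinct indices thus occupy distinct slots of the single weight sequence.
    have hs : Set.InjOn (fun i => m * τ (L i) i + e (L i)) (A.filter (· ∈ I)) := by
      intro i hi j hj hij
      dsimp only at hij
      have h1 : e (L i) = e (L j) := by
        have := congrArg (· % m) hij
        simpa [Nat.mul_add_mod, Nat.mod_eq_of_lt (he _)] using this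
      have h2 := he_inj h1
      rw [h1] at hij
      have h3 : τ (L i) i = τ (L j) j :=
        Nat.eq_of_mul_eq_mul_left (by have := he (L i); omega) (Nat.add_right_cancel hij)
      rw [h2] at h3
      exact hinj (L j) (Finset.mem_filter.1 hi).2 (Finset.mem_filter.1 hj).2 h3
    calc ∑ i ∈ A with i ∈ I, slowWeight m (τ (L i) i) / 2
        ≤ ∑ i ∈ A with i ∈ I, slowWeight m (m * τ (L i) i + e (L i)) :=
          Finset.sum_le_sum fun i _ => half_slowWeight_le _ (he _)
      _ ≤ slowSum m (A.filter (· ∈ I)).card := sum_slowWeight_comp_le m hs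
      _ ≤ slowSum m A.card := by
          refine Finset.sum_le_sum_of_subset_of_nonneg ?_ fun r _ _ => (slowWeight_pos m r).le
          exact Finset.range_subset_range.2 (Finset.card_le_card (Finset.filter_subset _ _))
  · refine (hτ l h hh).trans ?_
    rw [Finset.mul_sum, Finset.mul_sum]
    refine Finset.sum_le_sum fun i hi => ?_
    simp only [if_pos hi]
    nlinarith [mul_le_mul_of_nonneg_left (hL i l) (hβ l i hi)]


/-! ### The tree of atoms -/

/-- Labels of the generators: a root, children `child t g i` (the `i`-th child of `t` in its
`g`-th group) and normalized block differences `blk t g A`. -/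
inductive AtomTree : Type
  | root : AtomTree
  | child (t : AtomTree) (g i : ℕ) : AtomTree
  | blk (t : AtomTree) (g : ℕ) (A : Finset ℕ) : AtomTree

namespace AtomTree

/-- A node is pure if no block occurs on its path to the root. -/
def IsPure : AtomTree → Prop
  | root => True
  | child t _ _ => IsPure t
  | blk _ _ _ => False

/-- The edges on the path from the root (or from the last block) to a node. -/
def edges : AtomTree → Set (AtomTree × ℕ × ℕ)
  | root => ∅
  | child t g i => insert (t, g, i) (edges t)
  | blk _ _ _ => ∅

theorem edges_finite (t : AtomTree) : t.edges.Finite := by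
  induction t with
  | root => exact Set.finite_empty
  | child t g i ih => exact ih.insert _
  | blk t g A ih => exact Set.finite_empty

/-- The edges on the path to a node, as a finset. -/
def path (t : AtomTree) : Finset (AtomTree × ℕ × ℕ) := t.edges_finite.toFinset

theorem path_root : path root = ∅ := by simp [path, edges]

theorem sizeOf_lt_of_mem_edges {t : AtomTree} {p : AtomTree × ℕ × ℕ} (hp : p ∈ t.edges) :
    sizeOf p.1 < sizeOf t := by
  induction t with
  | root => exact hp.elim
  | child t g i ih =>
    rcases hp with rfl | hp
    · simp only [child.sizeOf_spec]; omega
    · have := ih hp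
      simp only [child.sizeOf_spec]; omega
  | blk t g A ih => exact hp.elim

theorem sum_path_child {M : Type*} [AddCommMonoid M] (t : AtomTree) (g i : ℕ)
    (f : AtomTree × ℕ × ℕ → M) :
    ∑ p ∈ path (child t g i), f p = f (t, g, i) + ∑ p ∈ path t, f p := by
  classical
  have h : path (child t g i) = insert (t, g, i) (path t) := by
    ext p
    simp [path, edges]
  have hnot : (t, g, i) ∉ path t := fun hmem =>
    lt_irrefl (sizeOf t)
      (sizeOf_lt_of_mem_edges (p := (t, g, i)) (t.edges_finite.mem_toFinset.1 hmem))
  rw [h, Finset.sum_insert hnot]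

-- Passes from masses at nodes to flows through edges: the coefficient of an edge is the total mass
-- lying beyond it.
open Classical in
theorem sum_mul_sum_path {R : Type*} [CommSemiring R] (F : Finset AtomTree)
    (D : Finset (AtomTree × ℕ × ℕ)) (hD : ∀ t ∈ F, path t ⊆ D) (b : AtomTree → R)
    (f : AtomTree × ℕ × ℕ → R) :
    ∑ t ∈ F, b t * ∑ p ∈ path t, f p = ∑ p ∈ D, (∑ t ∈ F with p ∈ path t, b t) * f p := by
  simp_rw [Finset.sum_mul, Finset.mul_sum]
  refine Finset.sum_comm' fun t p => ?_
  simp only [Finset.mem_filter]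
  exact ⟨fun h => ⟨h, hD _ h.1 h.2⟩, fun h => h.1⟩

/-! ### Admissible functions -/

variable {𝕜 : Type u} [RCLike 𝕜]

/-- The functions on the tree that come from functionals of norm at most one. -/
def IsAdmissible (m : ℕ) (φ : AtomTree → 𝕜) : Prop :=
  (∀ t, ‖φ t‖ ≤ 1) ∧ ∀ t g A, φ (blk t g A) =
    ((2 * slowSum m A.card : ℝ) : 𝕜)⁻¹ * ∑ i ∈ A, (φ (child t g i) - φ t)

theorem IsAdmissible.norm_sum_sub_le {m : ℕ} {φ : AtomTree → 𝕜} (h : IsAdmissible m φ)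
    (t : AtomTree) (g : ℕ) (A : Finset ℕ) :
    ‖∑ i ∈ A, (φ (child t g i) - φ t)‖ ≤ 2 * slowSum m A.card := by
  rcases A.eq_empty_or_nonempty with rfl | hA
  · simp [slowSum_zero]
  have hW := one_le_slowSum m (Finset.card_pos.2 hA)
  have h1 := h.1 (blk t g A)
  rw [h.2, norm_mul, norm_inv, RCLike.norm_ofReal, abs_of_pos (by linarith),
    inv_mul_le_iff₀ (by linarith), mul_one] at h1
  exact h1

/-- Killing rates whose partial sums in every group are controlled. -/
def IsRate (m : ℕ) (v : AtomTree → ℕ → ℕ → ℝ) : Prop :=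
  (∀ t g i, 0 ≤ v t g i) ∧ (∀ t g i, v t g i ≤ 1) ∧
    ∀ t g (A : Finset ℕ), ∑ i ∈ A, v t g i ≤ slowSum m A.card

/-- Survival probabilities along the tree for given killing rates. -/
def survival (m : ℕ) (v : AtomTree → ℕ → ℕ → ℝ) : AtomTree → ℝ
  | root => 1
  | child t g i => (1 - v t g i) * survival m v t
  | blk t g A => (1 - (slowSum m A.card)⁻¹ * ∑ i ∈ A, v t g i * survival m v t) / 2

variable {m : ℕ} {v : AtomTree → ℕ → ℕ → ℝ}

theorem survival_mem_Icc (hv : IsRate m v) (t : AtomTree) : survival m v t ∈ Set.Icc (0 : ℝ) 1 := by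
  induction t with
  | root => simp [survival]
  | child t g i ih =>
    have h1 := hv.1 t g i
    have h2 := hv.2.1 t g i
    exact ⟨mul_nonneg (by linarith) ih.1, mul_le_one₀ (by linarith) ih.1 ih.2⟩
  | blk t g A ih =>
    have h0 : 0 ≤ (slowSum m A.card)⁻¹ * ∑ i ∈ A, v t g i * survival m v t :=
      mul_nonneg (inv_nonneg.2 (slowSum_nonneg _ _))
        (Finset.sum_nonneg fun i _ => mul_nonneg (hv.1 t g i) ih.1)
    have h1 : (slowSum m A.card)⁻¹ * ∑ i ∈ A, v t g i * survival m v t ≤ 1 := by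
      rcases A.eq_empty_or_nonempty with rfl | hA
      · simp
      have hW := one_le_slowSum m (Finset.card_pos.2 hA)
      rw [inv_mul_le_iff₀ (by linarith), mul_one]
      refine le_trans (Finset.sum_le_sum fun i _ => ?_) (hv.2.2 t g A)
      exact mul_le_of_le_one_right (hv.1 t g i) ih.2
    simp only [survival, Set.mem_Icc]
    constructor <;> linarith

/-- Passing from `t` to a child lowers `2S - 1` by `2 v S`, so the block relation forces the value
`-W⁻¹ ∑ v S` at a block; the bound on partial sums of rates keeps it in `[-1, 0]`. -/
theorem isAdmissible_survival (hv : IsRate m v) :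
    IsAdmissible m (fun t => ((2 * survival m v t - 1 : ℝ) : 𝕜)) := by
  refine ⟨fun t => ?_, fun t g A => ?_⟩
  · have := survival_mem_Icc hv t
    rw [RCLike.norm_ofReal, abs_le]
    constructor <;> linarith [this.1, this.2]
  · have h : ∀ i, (2 * survival m v (child t g i) - 1) - (2 * survival m v t - 1) =
        -2 * (v t g i * survival m v t) := fun i => by simp only [survival]; ring
    rw [← RCLike.ofReal_inv]
    simp_rw [← RCLike.ofReal_sub, h]
    rw [← RCLike.ofReal_sum, ← RCLike.ofReal_mul, ← Finset.mul_sum]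
    congr 1
    simp only [survival]
    rw [mul_inv]
    ring

theorem survival_zero_of_isPure {t : AtomTree} (ht : t.IsPure) : survival m 0 t = 1 := by
  induction t with
  | root => rfl
  | child t g i ih => simp [survival, ih ht]
  | blk t g A ih => exact ht.elim

theorem survival_zero_of_not_isPure {t : AtomTree} (ht : ¬ t.IsPure) :
    survival m 0 t = 1 / 2 := by
  induction t with
  | root => exact (ht trivial).elim
  | child t g i ih => simp [survival, ih ht]
  | blk t g A ih => simp [survival]

/-- What fails to reach `t` was killed on exactly one edge of its path. -/
theorem one_sub_survival (t : AtomTree) (ht : t.IsPure) :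
    1 - survival m v t = ∑ p ∈ path t, survival m v p.1 * v p.1 p.2.1 p.2.2 := by
  induction t with
  | root => simp [survival, path_root]
  | child t g i ih =>
    rw [sum_path_child, ← ih ht]
    simp only [survival]
    ring
  | blk t g A ih => exact ht.elim

/-- A discrete product rule: telescope `S ψ` along the path. The increments of `ψ` are weighted by
survival, and the remaining terms are weighted by killed mass. -/
theorem sub_root_eq (ψ : AtomTree → 𝕜) (t : AtomTree) (ht : t.IsPure) :
    ψ t - ψ root =
      ∑ p ∈ path t, (survival m v p.1 : 𝕜) * (ψ (child p.1 p.2.1 p.2.2) - ψ p.1) -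
      ∑ p ∈ path t, ((survival m v p.1 * v p.1 p.2.1 p.2.2 : ℝ) : 𝕜) *
        ψ (child p.1 p.2.1 p.2.2) + ((1 - survival m v t : ℝ) : 𝕜) * ψ t := by
  induction t with
  | root => simp [survival, path_root]
  | child t g i ih =>
    have h := ih ht
    rw [sum_path_child, sum_path_child]
    simp only [survival]
    push_cast at h ⊢
    linear_combination h
  | blk t g A ih => exact ht.elim

/-- Finitely many mass distributions on pure nodes admit common killing rates for which the
killed mass controls the distance to the root in every direction. -/
theorem exists_rate (𝕜 : Type u) [RCLike 𝕜] {m : ℕ} {ι : Type*} [Fintype ι]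
    (hι : Fintype.card ι ≤ m) (F : Finset AtomTree) (hF : ∀ t ∈ F, t.IsPure)
    (b : ι → AtomTree → ℝ) (hb : ∀ l, ∀ t ∈ F, 0 ≤ b l t) :
    ∃ v, IsRate m v ∧ ∀ l, ∀ ψ : AtomTree → 𝕜, IsAdmissible m ψ →
      ‖∑ t ∈ F, (b l t : 𝕜) * (ψ t - ψ root)‖ ≤ 6 * ∑ t ∈ F, b l t * (1 - survival m v t) := by
  classical
  set P := F.biUnion path with hP
  set J := P.image fun p => p.2.2 with hJ
  set G := P.image fun p => p.2.1 with hG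
  set Q := P.image fun p => p.1 with hQ
  have hD : ∀ t ∈ F, path t ⊆ Q ×ˢ (G ×ˢ J) := by
    intro t ht p hp
    have hpP : p ∈ P := Finset.mem_biUnion.2 ⟨t, ht, hp⟩
    exact Finset.mem_product.2 ⟨Finset.mem_image_of_mem _ hpP,
      Finset.mem_product.2 ⟨Finset.mem_image_of_mem _ hpP, Finset.mem_image_of_mem _ hpP⟩⟩
  set D := Q ×ˢ (G ×ˢ J) with hDdef
  set β : ι → AtomTree × ℕ × ℕ → ℝ := fun l p => ∑ t ∈ F with p ∈ path t, b l t with hβ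
  have hβ0 : ∀ l p, 0 ≤ β l p := fun l p =>
    Finset.sum_nonneg fun t ht => hb l t (Finset.mem_filter.1 ht).1
  -- One common majorant for each group, serving all the flows `β l` at once.
  choose v hv0 hv1 hvs hv using fun (s : AtomTree) (g : ℕ) =>
    exists_common_weight 𝕜 hι J (fun l i => β l (s, g, i)) (fun l i _ => hβ0 l _)
  have hrate : IsRate m v := ⟨hv0, hv1, hvs⟩
  refine ⟨v, hrate, fun l ψ hψ => ?_⟩
  have hS := fun t => survival_mem_Icc hrate t
  set K := ∑ t ∈ F, b l t * (1 - survival m v t) with hK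
  have hKeq : K = ∑ p ∈ D, β l p * (survival m v p.1 * v p.1 p.2.1 p.2.2) := by
    rw [hK, ← sum_mul_sum_path F D hD]
    exact Finset.sum_congr rfl fun t ht => by rw [one_sub_survival t (hF t ht)]
  have hβ' : ∀ p, ∑ t ∈ F with p ∈ path t, (b l t : 𝕜) = (β l p : 𝕜) := fun p => by
    rw [hβ]; push_cast; rfl
  have hdecomp : ∑ t ∈ F, (b l t : 𝕜) * (ψ t - ψ root) =
      ∑ p ∈ D, (β l p : 𝕜) * ((survival m v p.1 : 𝕜) * (ψ (child p.1 p.2.1 p.2.2) - ψ p.1)) -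
      ∑ p ∈ D, (β l p : 𝕜) * (((survival m v p.1 * v p.1 p.2.1 p.2.2 : ℝ) : 𝕜) *
        ψ (child p.1 p.2.1 p.2.2)) +
      ∑ t ∈ F, (b l t : 𝕜) * (((1 - survival m v t : ℝ) : 𝕜) * ψ t) := by
    simp_rw [← hβ']
    rw [← sum_mul_sum_path F D hD, ← sum_mul_sum_path F D hD, ← Finset.sum_sub_distrib,
      ← Finset.sum_add_distrib]
    refine Finset.sum_congr rfl fun t ht => ?_
    rw [sub_root_eq (m := m) (v := v) ψ t (hF t ht)]
    ring
  -- Within one sibling group the survival factor of the parent is constant, so the majorant applies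
  -- group by group.
  have hA : ‖∑ p ∈ D, (β l p : 𝕜) *
      ((survival m v p.1 : 𝕜) * (ψ (child p.1 p.2.1 p.2.2) - ψ p.1))‖ ≤ 4 * K := by
    rw [hKeq, hDdef, Finset.sum_product, Finset.sum_product, Finset.mul_sum]
    refine norm_sum_le_of_le _ fun s _ => ?_
    rw [Finset.sum_product, Finset.sum_product, Finset.mul_sum]
    refine norm_sum_le_of_le _ fun g _ => ?_
    have h1 := hv s g l (fun i => ψ (child s g i) - ψ s) (hψ.norm_sum_sub_le s g)
    have h2 : ∑ i ∈ J, (β l (s, g, i) : 𝕜) *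
        ((survival m v s : 𝕜) * (ψ (child s g i) - ψ s)) =
        (survival m v s : 𝕜) * ∑ i ∈ J, (β l (s, g, i) : 𝕜) * (ψ (child s g i) - ψ s) := by
      rw [Finset.mul_sum]
      exact Finset.sum_congr rfl fun i _ => by ring
    have h3 : ∑ i ∈ J, β l (s, g, i) * (survival m v s * v s g i) =
        survival m v s * ∑ i ∈ J, β l (s, g, i) * v s g i := by
      rw [Finset.mul_sum]
      exact Finset.sum_congr rfl fun i _ => by ring
    dsimp only
    rw [h2, h3, norm_mul, RCLike.norm_ofReal, abs_of_nonneg (hS s).1]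
    calc _ ≤ survival m v s * (4 * ∑ i ∈ J, β l (s, g, i) * v s g i) :=
          mul_le_mul_of_nonneg_left h1 (hS s).1
      _ = _ := by ring
  have hB : ‖∑ p ∈ D, (β l p : 𝕜) * (((survival m v p.1 * v p.1 p.2.1 p.2.2 : ℝ) : 𝕜) *
      ψ (child p.1 p.2.1 p.2.2))‖ ≤ K := by
    rw [hKeq]
    refine norm_sum_le_of_le _ fun p _ => ?_
    have h0 := mul_nonneg (hS p.1).1 (hrate.1 p.1 p.2.1 p.2.2)
    rw [norm_mul, norm_mul, RCLike.norm_ofReal, RCLike.norm_ofReal, abs_of_nonneg (hβ0 l p),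
      abs_of_nonneg h0]
    exact mul_le_mul_of_nonneg_left (mul_le_of_le_one_right h0 (hψ.1 _)) (hβ0 l p)
  have hC : ‖∑ t ∈ F, (b l t : 𝕜) * (((1 - survival m v t : ℝ) : 𝕜) * ψ t)‖ ≤ K := by
    refine norm_sum_le_of_le _ fun t ht => ?_
    have h0 : 0 ≤ 1 - survival m v t := by linarith [(hS t).2]
    rw [norm_mul, norm_mul, RCLike.norm_ofReal, RCLike.norm_ofReal, abs_of_nonneg (hb l t ht),
      abs_of_nonneg h0]
    exact mul_le_mul_of_nonneg_left (mul_le_of_le_one_right h0 (hψ.1 _)) (hb l t ht)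
  rw [hdecomp]
  refine (norm_add_le _ _).trans ?_
  have := norm_sub_le
    (∑ p ∈ D, (β l p : 𝕜) * ((survival m v p.1 : 𝕜) * (ψ (child p.1 p.2.1 p.2.2) - ψ p.1)))
    (∑ p ∈ D, (β l p : 𝕜) * (((survival m v p.1 * v p.1 p.2.1 p.2.2 : ℝ) : 𝕜) *
        ψ (child p.1 p.2.1 p.2.2)))
  linarith

/-! ### Extending admissible functions along a fresh group -/

/-- A bound for the group labels occurring in a node. -/
def maxGroup : AtomTree → ℕ
  | root => 0
  | child t g _ => max (maxGroup t) g
  | blk t g _ => max (maxGroup t) g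

open Classical in
/-- Keep `φ` on the nodes with group labels below `g`, give `child t g i` the value `c`, and
extend by constants. -/
def extend (m : ℕ) (φ : AtomTree → 𝕜) (t : AtomTree) (g i : ℕ) (c : 𝕜) : AtomTree → 𝕜
  | root => φ root
  | child s k j => if max (maxGroup s) k < g then φ (child s k j) else
      if s = t ∧ k = g ∧ j = i then c else extend m φ t g i c s
  | blk s k A => if max (maxGroup s) k < g then φ (blk s k A) else
      if s = t ∧ k = g ∧ i ∈ A then ((2 * slowSum m A.card : ℝ) : 𝕜)⁻¹ * (c - φ t) else 0

theorem extend_of_lt {φ : AtomTree → 𝕜} {t : AtomTree} {g i : ℕ} {c : 𝕜} {s : AtomTree}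
    (hs : maxGroup s < g) : extend m φ t g i c s = φ s := by
  cases s with
  | root => rfl
  | child s k j => exact if_pos hs
  | blk s k A => exact if_pos hs

theorem extend_child {φ : AtomTree → 𝕜} {t : AtomTree} {g i : ℕ} {c : 𝕜} :
    extend m φ t g i c (child t g i) = c := by
  rw [extend, if_neg (by simp), if_pos ⟨rfl, rfl, rfl⟩]

/-- Only blocks of the group `(t, g)` containing `i` see the jump `c - φ t`. It has modulus at most
`2` and is divided by `2 W ≥ 2`, so `c` is free in the unit disc. -/
theorem isAdmissible_extend {φ : AtomTree → 𝕜} (hφ : IsAdmissible m φ) {t : AtomTree} {g : ℕ}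
    (ht : maxGroup t < g) (i : ℕ) {c : 𝕜} (hc : ‖c‖ ≤ 1) :
    IsAdmissible m (extend m φ t g i c) := by
  classical
  refine ⟨fun s => ?_, fun s k A => ?_⟩
  · induction s with
    | root => exact hφ.1 _
    | child s k j ih =>
      rw [extend]
      split_ifs
      exacts [hφ.1 _, hc, ih]
    | blk s k A ih =>
      rw [extend]
      split_ifs with h1 h2
      · exact hφ.1 _
      · have hW := one_le_slowSum m (Finset.card_pos.2 ⟨i, h2.2.2⟩)
        rw [norm_mul, norm_inv, RCLike.norm_ofReal, abs_of_pos (by linarith),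
          inv_mul_le_iff₀ (by linarith)]
        have := norm_sub_le c (φ t)
        have := hφ.1 t
        linarith
      · simp
  · by_cases h1 : max (maxGroup s) k < g
    · rw [extend, if_pos h1, hφ.2]
      congr 1
      refine Finset.sum_congr rfl fun j _ => ?_
      rw [extend, if_pos h1, extend_of_lt ((le_max_left _ _).trans_lt h1)]
    · rw [extend, if_neg h1]
      have hch : ∀ j, extend m φ t g i c (child s k j) =
          if s = t ∧ k = g ∧ j = i then c else extend m φ t g i c s := fun j => by
        rw [extend, if_neg h1]
      by_cases h2 : s = t ∧ k = g
      · obtain ⟨rfl, rfl⟩ := h2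
        have h3 : ∀ j, extend m φ s k i c (child s k j) - extend m φ s k i c s =
            if j = i then c - φ s else 0 := fun j => by
          rw [hch]
          by_cases hj : j = i
          · simp [hj, extend_of_lt ht]
          · simp [hj]
        rw [Finset.sum_congr rfl fun j _ => h3 j, Finset.sum_ite_eq']
        by_cases hi : i ∈ A <;> simp [hi]
      · have h3 : ∀ j, ¬ (s = t ∧ k = g ∧ j = i) := fun j h => h2 ⟨h.1, h.2.1⟩
        have h4 : ¬ (s = t ∧ k = g ∧ i ∈ A) := fun h => h2 ⟨h.1, h.2.1⟩
        simp [hch, h3, h4]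

end AtomTree


theorem lp_one_hasSum_norm {α : Type*} {E : α → Type*} [∀ i, NormedAddCommGroup (E i)]
    (f : lp E 1) : HasSum (fun i => ‖f i‖) ‖f‖ := by
  have h := lp.hasSum_norm (p := 1) (by simp) f
  simpa using h

/-! ### The space generated by the tree -/

namespace AtomTree

instance : DecidableEq AtomTree := Classical.decEq _

variable {𝕜 : Type u} [RCLike 𝕜] {m : ℕ}

/-- Pairing of `ℓ¹` with a bounded function on the tree. -/
def pairing (φ : AtomTree → 𝕜) (hφ : ∀ t, ‖φ t‖ ≤ 1) : lp (fun _ : AtomTree => 𝕜) 1 →L[𝕜] 𝕜 :=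
  have hb (b : lp (fun _ : AtomTree => 𝕜) 1) (t : AtomTree) : ‖b t * φ t‖ ≤ ‖b t‖ := by
    rw [norm_mul]
    exact mul_le_of_le_one_right (norm_nonneg _) (hφ t)
  have hs (b : lp (fun _ : AtomTree => 𝕜) 1) : Summable fun t => b t * φ t :=
    Summable.of_norm_bounded (lp_one_hasSum_norm b).summable (hb b)
  LinearMap.mkContinuous
    { toFun := fun b => ∑' t, b t * φ t
      map_add' := fun b c => by
        rw [← (hs b).tsum_add (hs c)]
        exact tsum_congr fun t => by simp [add_mul]
      map_smul' := fun r b => by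
        rw [RingHom.id_apply, smul_eq_mul, ← tsum_mul_left]
        exact tsum_congr fun t => by simp [mul_assoc] } 1 fun b => by
    rw [one_mul]
    exact tsum_of_norm_bounded (lp_one_hasSum_norm b) (hb b)

theorem pairing_apply (φ : AtomTree → 𝕜) (hφ : ∀ t, ‖φ t‖ ≤ 1)
    (b : lp (fun _ : AtomTree => 𝕜) 1) : pairing φ hφ b = ∑' t, b t * φ t := rfl

theorem norm_pairing_le (φ : AtomTree → 𝕜) (hφ : ∀ t, ‖φ t‖ ≤ 1)
    (b : lp (fun _ : AtomTree => 𝕜) 1) : ‖pairing φ hφ b‖ ≤ ‖b‖ := by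
  refine tsum_of_norm_bounded (lp_one_hasSum_norm b) fun t => ?_
  rw [norm_mul]
  exact mul_le_of_le_one_right (norm_nonneg _) (hφ t)

theorem pairing_single (φ : AtomTree → 𝕜) (hφ : ∀ t, ‖φ t‖ ≤ 1) (t : AtomTree) :
    pairing φ hφ (lp.single 1 t (1 : 𝕜)) = φ t := by
  rw [pairing_apply, tsum_eq_single t]
  · simp
  · intro s hs
    rw [lp.single_apply_ne _ _ _ hs, zero_mul]

variable (𝕜 m) in
/-- The elements of `ℓ¹` annihilated by all admissible functions. -/
def annihilated : Submodule 𝕜 (lp (fun _ : AtomTree => 𝕜) 1) where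
  carrier := {b | ∀ (φ : AtomTree → 𝕜) (h : IsAdmissible m φ), pairing φ h.1 b = 0}
  zero_mem' := fun φ h => map_zero _
  add_mem' := fun {a b} ha hb φ h => by rw [map_add, ha φ h, hb φ h, add_zero]
  smul_mem' := fun c b hb φ h => by rw [map_smul, hb φ h, smul_zero]

instance annihilated_isClosed :
    IsClosed (annihilated 𝕜 m : Set (lp (fun _ : AtomTree => 𝕜) 1)) := by
  have h : (annihilated 𝕜 m : Set (lp (fun _ : AtomTree => 𝕜) 1)) =
      ⋂ (φ : AtomTree → 𝕜) (h : IsAdmissible m φ), pairing φ h.1 ⁻¹' {0} := by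
    ext b
    simp [annihilated]
  rw [h]
  exact isClosed_iInter fun φ => isClosed_iInter fun h =>
    isClosed_singleton.preimage (pairing φ h.1).continuous

variable (𝕜 m) in
/-- The Banach space generated by the atoms. -/
abbrev TreeSpace : Type u := lp (fun _ : AtomTree => 𝕜) 1 ⧸ annihilated 𝕜 m

variable (𝕜 m) in
/-- The generators of `TreeSpace`. -/
def atom (t : AtomTree) : TreeSpace 𝕜 m := (annihilated 𝕜 m).mkQ (lp.single 1 t (1 : 𝕜))

theorem norm_atom_le (t : AtomTree) : ‖atom 𝕜 m t‖ ≤ 1 := by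
  refine (Submodule.Quotient.norm_mk_le (annihilated 𝕜 m) _).trans ?_
  rw [lp.norm_single (by simp)]
  simp

/-- The functional given by an admissible function. -/
def functional {φ : AtomTree → 𝕜} (h : IsAdmissible m φ) : TreeSpace 𝕜 m →L[𝕜] 𝕜 :=
  LinearMap.mkContinuous
    ((annihilated 𝕜 m).liftQ (pairing φ h.1).toLinearMap fun b hb => hb φ h) 1 fun x => by
    rw [one_mul]
    refine le_of_forall_pos_le_add fun ε hε => ?_
    obtain ⟨b, rfl, hb⟩ := Submodule.Quotient.norm_mk_lt x hε
    exact (norm_pairing_le φ h.1 b).trans hb.le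

theorem norm_functional_apply_le {φ : AtomTree → 𝕜} (h : IsAdmissible m φ) (x : TreeSpace 𝕜 m) :
    ‖functional h x‖ ≤ ‖x‖ := by
  have h1 : ‖functional h‖ ≤ 1 := LinearMap.mkContinuous_norm_le _ zero_le_one _
  simpa using (functional h).le_of_opNorm_le h1 x

theorem functional_atom {φ : AtomTree → 𝕜} (h : IsAdmissible m φ) (t : AtomTree) :
    functional h (atom 𝕜 m t) = φ t :=
  pairing_single φ h.1 t

theorem functional_sum {φ : AtomTree → 𝕜} (h : IsAdmissible m φ) (F : Finset AtomTree)
    (b : AtomTree → 𝕜) : functional h (∑ t ∈ F, b t • atom 𝕜 m t) = ∑ t ∈ F, b t * φ t := by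
  simp [map_sum, functional_atom]

theorem atom_blk (t : AtomTree) (g : ℕ) (A : Finset ℕ) :
    atom 𝕜 m (blk t g A) = ((2 * slowSum m A.card : ℝ) : 𝕜)⁻¹ •
      ∑ i ∈ A, (atom 𝕜 m (child t g i) - atom 𝕜 m t) := by
  simp only [atom, ← map_sub, ← map_sum, ← map_smul]
  refine (Submodule.Quotient.eq _).2 fun φ h => ?_
  simp only [map_sub, map_smul, map_sum, pairing_single, smul_eq_mul, h.2, sub_self]

theorem isAdmissible_comp_atom (f : TreeSpace 𝕜 m →L[𝕜] 𝕜) (hf : ‖f‖ ≤ 1) :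
    IsAdmissible m fun t => f (atom 𝕜 m t) := by
  refine ⟨fun t => ?_, fun t g A => ?_⟩
  · refine (f.le_of_opNorm_le hf _).trans ?_
    simpa using norm_atom_le t
  · dsimp only
    rw [atom_blk]
    simp

theorem exists_isAdmissible_eq_norm (x : TreeSpace 𝕜 m) :
    ∃ φ : AtomTree → 𝕜, IsAdmissible m φ ∧ ∀ (F : Finset AtomTree) (b : AtomTree → 𝕜),
      x = ∑ t ∈ F, b t • atom 𝕜 m t → ∑ t ∈ F, b t * φ t = (‖x‖ : 𝕜) := by
  obtain ⟨f, hf, hfx⟩ := exists_dual_vector'' 𝕜 x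
  refine ⟨_, isAdmissible_comp_atom f hf, fun F b hx => ?_⟩
  rw [← hfx]
  conv_rhs => rw [hx]
  simp [map_sum]

theorem hasSum_atom (b : lp (fun _ : AtomTree => 𝕜) 1) :
    HasSum (fun t => b t • atom 𝕜 m t) ((annihilated 𝕜 m).mkQ b) := by
  have h := (lp.hasSum_single (p := 1) (by simp) b).map (annihilated 𝕜 m).mkQ
    (annihilated 𝕜 m).mkQL.continuous
  convert h using 2 with t
  rw [Function.comp_apply, atom, ← map_smul, ← lp.single_smul]
  simp

/-- The atoms norm the dual, since the space is a quotient of `ℓ¹`; hence every slice of the ball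
meets the unimodular multiples of atoms. -/
theorem norm_apply_le_of_atom (f : TreeSpace 𝕜 m →L[𝕜] 𝕜) {C : ℝ}
    (hC : ∀ t, ‖f (atom 𝕜 m t)‖ ≤ C) (x : TreeSpace 𝕜 m) : ‖f x‖ ≤ C * ‖x‖ := by
  have hC0 : 0 ≤ C := (norm_nonneg _).trans (hC root)
  have key : ∀ b : lp (fun _ : AtomTree => 𝕜) 1, ‖f ((annihilated 𝕜 m).mkQ b)‖ ≤ C * ‖b‖ := by
    intro b
    have h := (hasSum_atom (m := m) b).mapL f
    rw [← h.tsum_eq]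
    refine tsum_of_norm_bounded ((lp_one_hasSum_norm b).mul_left C) fun t => ?_
    rw [map_smul, norm_smul, mul_comm]
    exact mul_le_mul_of_nonneg_right (hC t) (norm_nonneg _)
  refine le_of_forall_pos_le_add fun ε hε => ?_
  obtain ⟨b, rfl, hb⟩ := Submodule.Quotient.norm_mk_lt x (ε := ε / (C + 1)) (by positivity)
  refine (key b).trans ?_
  have h1 : C * (ε / (C + 1)) ≤ ε := by
    rw [mul_div_assoc', div_le_iff₀ (by positivity)]
    nlinarith
  have h2 := mul_le_mul_of_nonneg_left hb.le hC0
  linarith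

theorem exists_approx (x : TreeSpace 𝕜 m) {ε : ℝ} (hε : 0 < ε) :
    ∃ b : AtomTree → 𝕜, (∀ F : Finset AtomTree, ∑ t ∈ F, ‖b t‖ ≤ ‖x‖ + ε) ∧
      ∀ᶠ F : Finset AtomTree in atTop, ‖x - ∑ t ∈ F, b t • atom 𝕜 m t‖ < ε := by
  obtain ⟨b, rfl, hb⟩ := Submodule.Quotient.norm_mk_lt x hε
  refine ⟨b, fun F => ?_, ?_⟩
  · exact (sum_le_hasSum F (fun t _ => norm_nonneg _) (lp_one_hasSum_norm b)).trans hb.le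
  · filter_upwards [(Metric.tendsto_nhds.1 (hasSum_atom (m := m) b)) ε hε] with F hF
    rwa [dist_comm, dist_eq_norm] at hF

/-- Rescaling brings the total mass down to exactly the bound `1`. Holding for all large `F`, the
approximation permits one `F` for finitely many points. -/
theorem exists_approx_ball {x : TreeSpace 𝕜 m} (hx : ‖x‖ ≤ 1) {ε : ℝ} (hε : 0 < ε) :
    ∃ b : AtomTree → 𝕜, (∀ F : Finset AtomTree, ∑ t ∈ F, ‖b t‖ ≤ 1) ∧
      ∀ᶠ F : Finset AtomTree in atTop, ‖x - ∑ t ∈ F, b t • atom 𝕜 m t‖ < ε := by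
  obtain ⟨b, hb, hF⟩ := exists_approx x (half_pos hε)
  have h0 : 0 < 1 + ε / 2 := by positivity
  refine ⟨fun t => (((1 + ε / 2)⁻¹ : ℝ) : 𝕜) * b t, fun F => ?_, ?_⟩
  · simp_rw [norm_mul, RCLike.norm_ofReal, abs_of_pos (inv_pos.2 h0)]
    rw [← Finset.mul_sum, inv_mul_le_iff₀ h0, mul_one]
    linarith [hb F]
  · filter_upwards [hF] with F hF
    have h1 : ‖∑ t ∈ F, b t • atom 𝕜 m t‖ ≤ 1 + ε / 2 := by
      refine (norm_sum_le_of_le F fun t _ => ?_).trans ((hb F).trans (by linarith))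
      rw [norm_smul]
      exact mul_le_of_le_one_right (norm_nonneg _) (norm_atom_le t)
    simp_rw [mul_smul]
    rw [← Finset.smul_sum]
    set y := ∑ t ∈ F, b t • atom 𝕜 m t
    have h2 : y - (((1 + ε / 2)⁻¹ : ℝ) : 𝕜) • y = ((1 - (1 + ε / 2)⁻¹ : ℝ) : 𝕜) • y := by
      push_cast
      rw [sub_smul, one_smul]
    have h4 : (1 + ε / 2)⁻¹ ≤ 1 := inv_le_one_of_one_le₀ (by linarith)
    have h3 : ‖y - (((1 + ε / 2)⁻¹ : ℝ) : 𝕜) • y‖ ≤ ε / 2 := by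
      rw [h2, norm_smul, RCLike.norm_ofReal, abs_of_nonneg (by linarith)]
      refine (mul_le_mul_of_nonneg_left h1 (by linarith)).trans ?_
      rw [sub_mul, inv_mul_cancel₀ h0.ne']
      linarith
    have h5 := norm_sub_le_norm_sub_add_norm_sub x y ((((1 + ε / 2)⁻¹ : ℝ) : 𝕜) • y)
    linarith

/-! ### The Daugavet property of the tree space -/

theorem norm_sub_smul_atom_child (F : Finset AtomTree) (b : AtomTree → 𝕜) {t : AtomTree} {g : ℕ}
    (hF : ∀ s ∈ F, maxGroup s < g) (ht : maxGroup t < g) (i : ℕ) {ω : 𝕜} (hω : ‖ω‖ = 1) :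
    ‖∑ s ∈ F, b s • atom 𝕜 m s‖ + 1 ≤
      ‖∑ s ∈ F, b s • atom 𝕜 m s - ω • atom 𝕜 m (child t g i)‖ := by
  set x := ∑ s ∈ F, b s • atom 𝕜 m s with hx
  obtain ⟨φ, hφ, hφx⟩ := exists_isAdmissible_eq_norm x
  -- With this value at the child, `-ω • atom` contributes `+1` to a functional norming the sum.
  have hadm := isAdmissible_extend hφ ht i (c := -(starRingEnd 𝕜) ω) (by simp [hω])
  refine le_trans ?_ (norm_functional_apply_le hadm _)
  have h1 : functional hadm x = (‖x‖ : 𝕜) := by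
    rw [← hφx F b hx]
    conv_lhs => rw [hx]
    rw [functional_sum]
    exact Finset.sum_congr rfl fun s hs => by rw [extend_of_lt (hF s hs)]
  rw [map_sub, map_smul, functional_atom, extend_child, h1, smul_eq_mul, mul_neg,
    RCLike.mul_conj, hω, sub_neg_eq_add]
  norm_cast
  simpa using le_abs_self (‖x‖ + 1)

theorem exists_child_re_gt (hm : 0 < m) (f : TreeSpace 𝕜 m →L[𝕜] 𝕜) (t : AtomTree) (g : ℕ)
    {ω : 𝕜} (hω : ‖ω‖ = 1) {α : ℝ} (hα : 0 < α) :
    ∃ i, RCLike.re (f (ω • atom 𝕜 m t)) - α < RCLike.re (f (ω • atom 𝕜 m (child t g i))) := by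
  have hC : 0 < 2 * (‖f‖ + 1) := by positivity
  -- If all `k` children lost at least `α`, the block atom would force `k α ≤ 2 W(k) ‖f‖`; this `ε`
  -- makes that impossible.
  obtain ⟨k, hk, hW⟩ := exists_slowSum_le hm (ε := α / (2 * (‖f‖ + 1))) (by positivity)
  by_contra! hcon
  have hk' : (0 : ℝ) < k := by exact_mod_cast hk
  have hW1 := one_le_slowSum m hk
  have h1 := atom_blk (𝕜 := 𝕜) (m := m) t g (Finset.range k)
  rw [Finset.card_range] at h1
  have h2 : ∑ i ∈ Finset.range k, (f (ω • atom 𝕜 m t) - f (ω • atom 𝕜 m (child t g i))) =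
      -(ω * (((2 * slowSum m k : ℝ) : 𝕜) * f (atom 𝕜 m (blk t g (Finset.range k))))) := by
    have hne : ((2 * slowSum m k : ℝ) : 𝕜) ≠ 0 := by
      rw [Ne, RCLike.ofReal_eq_zero]
      linarith
    rw [h1, f.map_smul (_⁻¹), smul_eq_mul, mul_inv_cancel_left₀ hne, map_sum, Finset.mul_sum,
      ← Finset.sum_neg_distrib]
    refine Finset.sum_congr rfl fun i _ => ?_
    simp only [map_smul, map_sub, smul_eq_mul]
    ring
  have h3 : (k : ℝ) * α ≤ RCLike.re
      (∑ i ∈ Finset.range k, (f (ω • atom 𝕜 m t) - f (ω • atom 𝕜 m (child t g i)))) := by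
    rw [map_sum]
    have := Finset.card_nsmul_le_sum (Finset.range k)
      (fun i => RCLike.re (f (ω • atom 𝕜 m t) - f (ω • atom 𝕜 m (child t g i)))) α
      (fun i _ => by rw [map_sub]; linarith [hcon i])
    simpa using this
  have h4 : ‖f (atom 𝕜 m (blk t g (Finset.range k)))‖ ≤ ‖f‖ := by
    refine (f.le_opNorm _).trans ?_
    exact mul_le_of_le_one_right (norm_nonneg _) (norm_atom_le _)
  have h5 := h3.trans (RCLike.re_le_norm _)
  rw [h2, norm_neg, norm_mul, norm_mul, hω, one_mul, RCLike.norm_ofReal,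
    abs_of_pos (by linarith)] at h5
  have h6 : 2 * slowSum m k * ‖f (atom 𝕜 m (blk t g (Finset.range k)))‖ ≤
      2 * slowSum m k * ‖f‖ := mul_le_mul_of_nonneg_left h4 (by linarith)
  rw [div_mul_eq_mul_div, le_div_iff₀ hC] at hW
  nlinarith

theorem hasDaugavetProperty_treeSpace (hm : 0 < m) : HasDaugavetProperty 𝕜 (TreeSpace 𝕜 m) := by
  rintro S ⟨f, α, hα, rfl⟩ x hx ε hε
  set B := Metric.closedBall (0 : TreeSpace 𝕜 m) 1 with hB
  set s := sSup ((fun y => RCLike.re (f y)) '' B) with hs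
  have hatom : ∀ t (ω : 𝕜), ‖ω‖ = 1 → ω • atom 𝕜 m t ∈ B := fun t ω hω => by
    rw [hB, mem_closedBall_zero_iff, norm_smul, hω, one_mul]
    exact norm_atom_le t
  obtain ⟨t, ω, hω, htω⟩ : ∃ (t : AtomTree) (ω : 𝕜), ‖ω‖ = 1 ∧
      s - α / 2 < RCLike.re (f (ω • atom 𝕜 m t)) := by
    by_contra! hcon
    have h1 : ∀ t, ‖f (atom 𝕜 m t)‖ ≤ s - α / 2 := fun t => by
      obtain ⟨ω, hω, h⟩ := RCLike.exists_norm_eq_mul_self (f (atom 𝕜 m t))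
      have := hcon t ω hω
      rwa [map_smul, smul_eq_mul, ← h, RCLike.ofReal_re] at this
    have h0 : 0 ≤ s - α / 2 := (norm_nonneg _).trans (h1 root)
    have h2 : s ≤ s - α / 2 := by
      refine csSup_le ⟨_, 0, by simp [hB], rfl⟩ ?_
      rintro _ ⟨y, hy, rfl⟩
      refine (RCLike.re_le_norm _).trans ((norm_apply_le_of_atom f h1 y).trans ?_)
      exact mul_le_of_le_one_right h0 (mem_closedBall_zero_iff.1 hy)
    linarith
  obtain ⟨b, -, hF⟩ := exists_approx x (ε := ε / 3) (by positivity)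
  obtain ⟨F, hF⟩ := hF.exists
  set g := max (F.sup maxGroup) (maxGroup t) + 1 with hg
  obtain ⟨i, hi⟩ := exists_child_re_gt hm f t g hω (half_pos hα)
  refine ⟨ω • atom 𝕜 m (child t g i), ⟨hatom _ _ hω, by linarith⟩, ?_⟩
  have h1 := norm_sub_smul_atom_child (𝕜 := 𝕜) (m := m) F b (t := t) (g := g)
    (fun s hs => Nat.lt_succ_of_le ((Finset.le_sup hs).trans (le_max_left _ _)))
    (Nat.lt_succ_of_le (le_max_right _ _)) i hω
  set x' := ∑ s ∈ F, b s • atom 𝕜 m s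
  have h2 := norm_sub_le_norm_sub_add_norm_sub x' x (ω • atom 𝕜 m (child t g i))
  have h3 := norm_sub_norm_le x x'
  rw [norm_sub_rev x' x] at h2
  rw [mem_sphere_zero_iff_norm.1 hx] at h3
  linarith

end AtomTree

namespace AtomTree

variable {𝕜 : Type u} [RCLike 𝕜] {m : ℕ}

/-! ### Convex stability of the root -/

theorem functional_survival_root {v : AtomTree → ℕ → ℕ → ℝ} (hv : IsRate m v) :
    functional (isAdmissible_survival (𝕜 := 𝕜) hv) (atom 𝕜 m root) = 1 := by
  rw [functional_atom, survival, show (2 * 1 - 1 : ℝ) = 1 by norm_num, RCLike.ofReal_one]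

theorem isRate_zero : IsRate m 0 :=
  ⟨by simp, by simp, fun t g A => by simpa using slowSum_nonneg _ _⟩

/-- Each unit of positive mass killed costs twice itself in the functional `2S - 1`. -/
theorem re_mul_le_norm_sub {z : 𝕜} {s c : ℝ} (hs : s ∈ Set.Icc (0 : ℝ) 1)
    (hc : c = 0 ∨ c = max (RCLike.re z) 0) :
    RCLike.re z * (2 * s - 1) ≤ ‖z‖ - 2 * (c * (1 - s)) := by
  have h := abs_le.1 (RCLike.abs_re_le_norm z)
  rcases hc with rfl | rfl
  · nlinarith [hs.1, hs.2]
  · rcases le_total 0 (RCLike.re z) with h0 | h0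
    · rw [max_eq_left h0]; nlinarith [hs.1, hs.2]
    · rw [max_eq_right h0]; nlinarith [hs.1, hs.2]

theorem norm_sub_ofReal_max_le {z : 𝕜} {τ κ : ℝ}
    (hτκ : |RCLike.im z| ≤ τ * ‖z‖ + κ * (‖z‖ - RCLike.re z)) :
    ‖z - ((max (RCLike.re z) 0 : ℝ) : 𝕜)‖ - max (RCLike.re z) 0 ≤
      τ * ‖z‖ + κ * (‖z‖ - RCLike.re z) + ‖z‖ - 2 * RCLike.re z := by
  have h := abs_le.1 (RCLike.abs_re_le_norm z)
  have h0' := (abs_nonneg _).trans hτκ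
  rcases le_total 0 (RCLike.re z) with h0 | h0
  · rw [max_eq_left h0]
    have h1 : ‖z - (RCLike.re z : 𝕜)‖ ^ 2 = |RCLike.im z| ^ 2 := by
      rw [RCLike.norm_sq_eq_def, sq_abs]
      simp [sq]
    rw [sq_eq_sq₀ (norm_nonneg _) (abs_nonneg _)] at h1
    linarith
  · rw [max_eq_right h0]
    simp only [RCLike.ofReal_zero, sub_zero]
    linarith

-- Two functionals detect the deviation. The one with rates `v` controls the displacement of the
-- positive pure part `c`, giving `6 / 2 = 3`. The one with zero rates is `1` on pure and `0` on
-- impure nodes; it controls everything else, giving `2 + κ` and the error `τ`.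
open Classical in
theorem sum_mul_norm_sub_atom_root_le_aux {ι : Type*} [Fintype ι] (hι : Fintype.card ι ≤ m)
    {τ κ : ℝ} (hτ : 0 ≤ τ) (hκ : 0 ≤ κ)
    (hτκ : ∀ z : 𝕜, |RCLike.im z| ≤ τ * ‖z‖ + κ * (‖z‖ - RCLike.re z))
    (F : Finset AtomTree) (b : ι → AtomTree → 𝕜) (hb : ∀ l, ∑ t ∈ F, ‖b l t‖ ≤ 1)
    (w : ι → ℝ) (hw : ∀ l, 0 ≤ w l) (hw1 : ∑ l, w l = 1) :
    ∑ l, w l * ‖∑ t ∈ F, b l t • atom 𝕜 m t - atom 𝕜 m root‖ ≤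
      (5 + κ) * ‖∑ l, (w l : 𝕜) • ∑ t ∈ F, b l t • atom 𝕜 m t - atom 𝕜 m root‖ + τ := by
  set x₀ := atom 𝕜 m root with hx₀
  set z : ι → TreeSpace 𝕜 m := fun l => ∑ t ∈ F, b l t • atom 𝕜 m t with hz
  set d := ‖∑ l, (w l : 𝕜) • z l - x₀‖ with hd
  set c : ι → AtomTree → ℝ := fun l t => if t.IsPure then max (RCLike.re (b l t)) 0 else 0 with hc
  have hc0 : ∀ l t, 0 ≤ c l t := fun l t => by
    simp only [hc]; split_ifs <;> simp
  obtain ⟨v, hv, hvm⟩ := exists_rate 𝕜 hι (F.filter IsPure) (fun t ht => (Finset.mem_filter.1 ht).2)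
    c fun l t _ => hc0 l t
  have hSI := survival_mem_Icc hv
  have h0 : IsRate m 0 := isRate_zero
  have hφ := isAdmissible_survival (𝕜 := 𝕜) hv
  have hφ0 := isAdmissible_survival (𝕜 := 𝕜) h0
  -- Each such functional is `1` at the root, so its average defect on the `z l` is at most `d`.
  have hclose : ∀ (v : AtomTree → ℕ → ℕ → ℝ) (hv : IsRate m v),
      ∑ l, w l * (1 - RCLike.re (functional (isAdmissible_survival (𝕜 := 𝕜) hv) (z l))) ≤ d := by
    intro v hv
    set f := functional (isAdmissible_survival (𝕜 := 𝕜) hv)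
    have hroot : f x₀ = 1 := functional_survival_root hv
    have h1 : ∑ l, w l * (1 - RCLike.re (f (z l))) =
        -RCLike.re (f (∑ l, (w l : 𝕜) • z l - x₀)) := by
      rw [map_sub, map_sum, hroot]
      simp only [map_sub, map_sum, map_smul, smul_eq_mul, RCLike.re_ofReal_mul, mul_sub, mul_one,
        Finset.sum_sub_distrib, hw1, RCLike.one_re]
      ring
    rw [h1]
    exact (neg_le_abs _).trans ((RCLike.abs_re_le_norm _).trans (norm_functional_apply_le _ _))
  set f := functional hφ with hf
  set f₀ := functional hφ0 with hf₀
  have hf₀z : ∀ l, RCLike.re (f₀ (z l)) =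
      ∑ t ∈ F, if t.IsPure then RCLike.re (b l t) else 0 := fun l => by
    rw [functional_sum, map_sum]
    refine Finset.sum_congr rfl fun t _ => ?_
    rw [RCLike.re_mul_ofReal]
    split_ifs with ht
    · rw [survival_zero_of_isPure ht]; ring
    · rw [survival_zero_of_not_isPure ht]; ring
  have hfz : ∀ l, 2 * ∑ t ∈ F, c l t * (1 - survival m v t) ≤ 1 - RCLike.re (f (z l)) := fun l => by
    rw [functional_sum, map_sum]
    have h1 : ∑ t ∈ F, RCLike.re (b l t * ((2 * survival m v t - 1 : ℝ) : 𝕜)) ≤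
        ∑ t ∈ F, (‖b l t‖ - 2 * (c l t * (1 - survival m v t))) := by
      refine Finset.sum_le_sum fun t _ => ?_
      rw [RCLike.re_mul_ofReal]
      refine re_mul_le_norm_sub (hSI t) ?_
      simp only [hc]
      split_ifs <;> simp
    rw [Finset.sum_sub_distrib, ← Finset.mul_sum] at h1
    linarith [hb l]
  have hpure : ∀ l, ‖∑ t ∈ F, (c l t : 𝕜) • (atom 𝕜 m t - x₀)‖ ≤
      6 * ∑ t ∈ F, c l t * (1 - survival m v t) := fun l => by
    obtain ⟨ψ, hψ, hψx⟩ := exists_dual_vector'' 𝕜 (∑ t ∈ F, (c l t : 𝕜) • (atom 𝕜 m t - x₀))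
    have h1 := hvm l _ (isAdmissible_comp_atom ψ hψ)
    rw [Finset.sum_filter, Finset.sum_filter] at h1
    have h2 : ψ (∑ t ∈ F, (c l t : 𝕜) • (atom 𝕜 m t - x₀)) =
        ∑ t ∈ F, if t.IsPure then (c l t : 𝕜) * (ψ (atom 𝕜 m t) - ψ (atom 𝕜 m root)) else 0 := by
      rw [map_sum]
      refine Finset.sum_congr rfl fun t _ => ?_
      rw [map_smul, map_sub, smul_eq_mul]
      split_ifs with ht
      · rfl
      · simp [hc, ht]
    have h3 : ∑ t ∈ F, c l t * (1 - survival m v t) =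
        ∑ t ∈ F, if t.IsPure then c l t * (1 - survival m v t) else 0 := by
      refine Finset.sum_congr rfl fun t _ => ?_
      split_ifs with ht
      · rfl
      · simp [hc, ht]
    rw [← h2, ← h3, hψx, RCLike.norm_ofReal, abs_of_nonneg (norm_nonneg _)] at h1
    exact h1
  have hrest : ∀ l, ‖z l - x₀ - ∑ t ∈ F, (c l t : 𝕜) • (atom 𝕜 m t - x₀)‖ ≤
      (2 + κ) * (1 - RCLike.re (f₀ (z l))) + τ := fun l => by
    have h1 : z l - x₀ - ∑ t ∈ F, (c l t : 𝕜) • (atom 𝕜 m t - x₀) =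
        ∑ t ∈ F, (b l t - (c l t : 𝕜)) • atom 𝕜 m t - ((1 - ∑ t ∈ F, c l t : ℝ) : 𝕜) • x₀ := by
      simp only [hz, smul_sub, sub_smul, Finset.sum_sub_distrib, RCLike.ofReal_sub,
        RCLike.ofReal_one, one_smul, RCLike.ofReal_sum, Finset.sum_smul]
      abel
    have h2 : ∀ t ∈ F, ‖b l t - (c l t : 𝕜)‖ - c l t ≤ τ * ‖b l t‖ +
        κ * (‖b l t‖ - (if t.IsPure then RCLike.re (b l t) else 0)) + ‖b l t‖ -
        2 * (if t.IsPure then RCLike.re (b l t) else 0) := fun t _ => by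
      simp only [hc]
      split_ifs
      · exact norm_sub_ofReal_max_le (hτκ _)
      · have := mul_nonneg hτ (norm_nonneg (b l t))
        have := mul_nonneg hκ (norm_nonneg (b l t))
        simp only [RCLike.ofReal_zero, sub_zero, mul_zero]
        linarith
    have h3 := Finset.sum_le_sum h2
    simp only [Finset.sum_sub_distrib, Finset.sum_add_distrib, ← Finset.mul_sum, ← hf₀z] at h3
    have hcb : ∑ t ∈ F, c l t ≤ 1 := by
      refine (Finset.sum_le_sum fun t _ => ?_).trans (hb l)
      simp only [hc]
      split_ifs
      · exact max_le (RCLike.re_le_norm _) (norm_nonneg _)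
      · exact norm_nonneg _
    rw [h1]
    have h4 : ‖∑ t ∈ F, (b l t - (c l t : 𝕜)) • atom 𝕜 m t‖ ≤ ∑ t ∈ F, ‖b l t - (c l t : 𝕜)‖ := by
      refine norm_sum_le_of_le F fun t _ => ?_
      rw [norm_smul]
      exact mul_le_of_le_one_right (norm_nonneg _) (norm_atom_le t)
    have h5 : ‖((1 - ∑ t ∈ F, c l t : ℝ) : 𝕜) • x₀‖ ≤ 1 - ∑ t ∈ F, c l t := by
      rw [norm_smul, RCLike.norm_ofReal, abs_of_nonneg (by linarith)]
      exact mul_le_of_le_one_right (by linarith) (norm_atom_le _)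
    refine (norm_sub_le _ _).trans ?_
    have h6 := mul_le_mul_of_nonneg_left (hb l) hτ
    have h7 := mul_le_mul_of_nonneg_left (hb l) hκ
    have := hb l
    nlinarith
  have hmain : ∀ l, ‖z l - x₀‖ ≤ 3 * (1 - RCLike.re (f (z l))) +
      (2 + κ) * (1 - RCLike.re (f₀ (z l))) + τ := fun l => by
    have h1 := norm_add_le (z l - x₀ - ∑ t ∈ F, (c l t : 𝕜) • (atom 𝕜 m t - x₀))
      (∑ t ∈ F, (c l t : 𝕜) • (atom 𝕜 m t - x₀))
    rw [sub_add_cancel] at h1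
    linarith [hfz l, hpure l, hrest l]
  calc ∑ l, w l * ‖z l - x₀‖ ≤ ∑ l, w l * (3 * (1 - RCLike.re (f (z l))) +
        (2 + κ) * (1 - RCLike.re (f₀ (z l))) + τ) :=
        Finset.sum_le_sum fun l _ => mul_le_mul_of_nonneg_left (hmain l) (hw l)
    _ = 3 * ∑ l, w l * (1 - RCLike.re (f (z l))) +
        (2 + κ) * ∑ l, w l * (1 - RCLike.re (f₀ (z l))) + τ * ∑ l, w l := by
        rw [Finset.mul_sum, Finset.mul_sum, Finset.mul_sum, ← Finset.sum_add_distrib,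
          ← Finset.sum_add_distrib]
        exact Finset.sum_congr rfl fun l _ => by ring
    _ ≤ (5 + κ) * d + τ := by
        rw [hw1]
        have h1 := hclose v hv
        have h2 := mul_le_mul_of_nonneg_left (hclose 0 h0) (by linarith : 0 ≤ 2 + κ)
        linarith

/-- The root is, quantitatively, an extreme point with respect to convex combinations of at most
`m` points of the unit ball. -/
theorem sum_mul_norm_sub_atom_root_le {ι : Type*} [Fintype ι] (hι : Fintype.card ι ≤ m)
    {τ κ : ℝ} (hτ : 0 ≤ τ) (hκ : 0 ≤ κ)
    (hτκ : ∀ z : 𝕜, |RCLike.im z| ≤ τ * ‖z‖ + κ * (‖z‖ - RCLike.re z))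
    (z : ι → TreeSpace 𝕜 m) (hz : ∀ l, ‖z l‖ ≤ 1)
    (w : ι → ℝ) (hw : ∀ l, 0 ≤ w l) (hw1 : ∑ l, w l = 1) :
    ∑ l, w l * ‖z l - atom 𝕜 m root‖ ≤
      (5 + κ) * ‖∑ l, (w l : 𝕜) • z l - atom 𝕜 m root‖ + τ := by
  refine le_of_forall_pos_le_add fun ε hε => ?_
  have hε' : 0 < ε / (6 + κ) := by positivity
  set δ := ε / (6 + κ) with hδ
  have hδε : (6 + κ) * δ = ε := by rw [hδ]; field_simp
  choose b hb hF using fun l => exists_approx_ball (hz l) hε'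
  obtain ⟨F, hF⟩ := (eventually_all.2 hF).exists
  have key := sum_mul_norm_sub_atom_root_le_aux hι hτ hκ hτκ F b (fun l => hb l F) w hw hw1
  set x₀ := atom 𝕜 m root
  set y : ι → TreeSpace 𝕜 m := fun l => ∑ t ∈ F, b l t • atom 𝕜 m t
  have h1 : ∑ l, w l * ‖z l - x₀‖ ≤ ∑ l, w l * ‖y l - x₀‖ + δ := by
    calc ∑ l, w l * ‖z l - x₀‖ ≤ ∑ l, w l * (‖y l - x₀‖ + δ) :=
          Finset.sum_le_sum fun l _ => mul_le_mul_of_nonneg_left (by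
            linarith [norm_sub_le_norm_sub_add_norm_sub (z l) (y l) x₀, hF l]) (hw l)
      _ = _ := by simp only [mul_add, Finset.sum_add_distrib, ← Finset.sum_mul, hw1, one_mul]
  have h2 : ‖∑ l, (w l : 𝕜) • y l - ∑ l, (w l : 𝕜) • z l‖ ≤ δ := by
    rw [← Finset.sum_sub_distrib]
    calc _ ≤ ∑ l, w l * δ := norm_sum_le_of_le _ fun l _ => by
          rw [← smul_sub, norm_smul, RCLike.norm_ofReal, abs_of_nonneg (hw l), norm_sub_rev]
          exact mul_le_mul_of_nonneg_left (hF l).le (hw l)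
      _ = δ := by rw [← Finset.sum_mul, hw1, one_mul]
  have h3 := norm_sub_le_norm_sub_add_norm_sub (∑ l, (w l : 𝕜) • y l) (∑ l, (w l : 𝕜) • z l) x₀
  have h4 := mul_le_mul_of_nonneg_left (h3.trans (add_le_add_left h2 _)) (by linarith : 0 ≤ 5 + κ)
  linarith

theorem norm_atom_root : ‖atom 𝕜 m root‖ = 1 := by
  refine le_antisymm (norm_atom_le _) ?_
  have h := norm_functional_apply_le (isAdmissible_survival (𝕜 := 𝕜) isRate_zero) (atom 𝕜 m root)
  rwa [functional_survival_root isRate_zero, norm_one] at h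

/-- The square of the imaginary part is at most `2 ‖z‖ (‖z‖ - re z)`, followed by the
arithmetic-geometric mean inequality. Over the reals `τ = κ = 0` is possible, which gives the better
constant. -/
theorem abs_im_le (z : 𝕜) {τ : ℝ} (hτ : 0 < τ) :
    |RCLike.im z| ≤ τ * ‖z‖ + τ⁻¹ * (‖z‖ - RCLike.re z) := by
  have h1 : 0 ≤ ‖z‖ - RCLike.re z := sub_nonneg.2 (RCLike.re_le_norm z)
  have h2 := RCLike.norm_sq_eq_def (z := z)
  have hτ' : τ * τ⁻¹ = 1 := mul_inv_cancel₀ hτ.ne'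
  have h3 : 0 ≤ τ⁻¹ := inv_nonneg.2 hτ.le
  have h4 := abs_le.1 (RCLike.abs_re_le_norm z)
  refine abs_le_of_sq_le_sq ?_ (by positivity)
  have h5 : 0 ≤ (τ * ‖z‖ - τ⁻¹ * (‖z‖ - RCLike.re z)) ^ 2 := sq_nonneg _
  have h6 : (τ * ‖z‖ + τ⁻¹ * (‖z‖ - RCLike.re z)) ^ 2 =
      (τ * ‖z‖ - τ⁻¹ * (‖z‖ - RCLike.re z)) ^ 2 +
        4 * (τ * τ⁻¹) * (‖z‖ * (‖z‖ - RCLike.re z)) := by ring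
  rw [h6, hτ']
  nlinarith

end AtomTree

theorem lp_sum_smul_apply {𝕜 α : Type*} [NormedField 𝕜] {E : α → Type*}
    [∀ i, NormedAddCommGroup (E i)] [∀ i, NormedSpace 𝕜 (E i)] {p : ℝ≥0∞} {ι : Type*}
    (s : Finset ι) (c : ι → 𝕜) (z : ι → lp E p) (i : α) :
    (∑ l ∈ s, c l • z l) i = ∑ l ∈ s, c l • z l i := by
  change lp.evalₗ (𝕜 := 𝕜) E p i (∑ l ∈ s, c l • z l) = _
  rw [map_sum]
  rfl

/-! ### Slices and the Daugavet property -/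

section Daugavet

variable {𝕜 : Type u} [RCLike 𝕜] {X : Type*} [NormedAddCommGroup X] [NormedSpace 𝕜 X]

theorem bddAbove_re_image_closedBall (f : StrongDual 𝕜 X) :
    BddAbove ((fun y => RCLike.re (f y)) '' Metric.closedBall (0 : X) 1) := by
  refine ⟨‖f‖, ?_⟩
  rintro _ ⟨y, hy, rfl⟩
  refine (RCLike.re_le_norm _).trans ((f.le_opNorm y).trans ?_)
  exact mul_le_of_le_one_right (norm_nonneg _) (mem_closedBall_zero_iff.1 hy)

theorem IsSliceOfUnitBall.subset_closedBall {S : Set X} (hS : IsSliceOfUnitBall 𝕜 X S) :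
    S ⊆ Metric.closedBall 0 1 := by
  obtain ⟨f, α, -, rfl⟩ := hS
  exact fun x hx => hx.1

theorem HasDaugavetProperty.exists_norm_add_one_lt [Nontrivial X] (h : HasDaugavetProperty 𝕜 X)
    {S : Set X} (hS : IsSliceOfUnitBall 𝕜 X S) {x : X} (hx : ‖x‖ ≤ 1) {ε : ℝ} (hε : 0 < ε) :
    ∃ y ∈ S, ‖x‖ + 1 - ε < ‖x - y‖ := by
  let _ := NormedSpace.restrictScalars ℝ 𝕜 X
  rcases eq_or_ne x 0 with rfl | hx0
  · obtain ⟨u, hu⟩ : (Metric.sphere (0 : X) 1).Nonempty :=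
      NormedSpace.sphere_nonempty.2 zero_le_one
    obtain ⟨y, hy, hxy⟩ := h S hS u hu ε hε
    refine ⟨y, hy, ?_⟩
    have := norm_sub_le u y
    rw [mem_sphere_zero_iff_norm.1 hu] at this
    rw [norm_zero, zero_sub, norm_neg]
    linarith
  · have hpos : 0 < ‖x‖ := norm_pos_iff.2 hx0
    obtain ⟨y, hy, hxy⟩ := h S hS (‖x‖⁻¹ • x) (by
      rw [mem_sphere_zero_iff_norm, norm_smul, norm_inv, norm_norm, inv_mul_cancel₀ hpos.ne']) ε hε
    refine ⟨y, hy, ?_⟩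
    have h1 : ‖‖x‖⁻¹ • x - x‖ = 1 - ‖x‖ := by
      have : ‖x‖⁻¹ • x - x = (‖x‖⁻¹ - 1) • x := by rw [sub_smul, one_smul]
      rw [this, norm_smul, Real.norm_of_nonneg (sub_nonneg.2 (one_le_inv_iff₀.2 ⟨hpos, hx⟩)),
        sub_mul, inv_mul_cancel₀ hpos.ne', one_mul]
    have h2 := norm_sub_le_norm_sub_add_norm_sub (‖x‖⁻¹ • x) x y
    linarith

theorem HasDaugavetProperty.hasSliceD2P [Nontrivial X] (h : HasDaugavetProperty 𝕜 X) :
    HasSliceD2P 𝕜 X := by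
  intro S hS
  have hsub := hS.subset_closedBall
  have hbdd : Bornology.IsBounded S := Metric.isBounded_closedBall.subset hsub
  refine le_antisymm ?_ ?_
  · refine Metric.diam_le_of_forall_dist_le zero_le_two fun x hx y hy => ?_
    rw [dist_eq_norm]
    have h1 := norm_sub_le x y
    have h2 := mem_closedBall_zero_iff.1 (hsub hx)
    have h3 := mem_closedBall_zero_iff.1 (hsub hy)
    linarith
  · refine le_of_forall_pos_le_add fun ε hε => ?_
    obtain ⟨y, hy, hy1⟩ := h.exists_norm_add_one_lt hS (x := 0) (by simp) (half_pos hε)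
    rw [norm_zero, zero_sub, norm_neg] at hy1
    obtain ⟨z, hz, hz1⟩ := h.exists_norm_add_one_lt hS
      (mem_closedBall_zero_iff.1 (hsub hy)) (half_pos hε)
    have := Metric.dist_le_diam_of_mem hbdd hy hz
    rw [dist_eq_norm] at this
    linarith

end Daugavet

/-! ### Sums in the sense of `ℓ¹` -/

section Sum

variable {𝕜 : Type u} [RCLike 𝕜] {X : ℕ → Type*} [∀ n, NormedAddCommGroup (X n)]

theorem lp_one_norm_sub_single (x : lp X 1) (n : ℕ) (y : X n) :
    ‖x - lp.single 1 n y‖ = ‖x n - y‖ - ‖x n‖ + ‖x‖ := by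
  have h := (lp_one_hasSum_norm x).update n ‖x n - y‖
  have h1 : (fun i => ‖(x - lp.single 1 n y) i‖) =
      Function.update (fun i => ‖x i‖) n ‖x n - y‖ := by
    funext i
    rcases eq_or_ne i n with rfl | hi
    · simp
    · rw [Function.update_of_ne hi, lp.coeFn_sub, Pi.sub_apply, lp.single_apply_ne _ _ _ hi,
        sub_zero]
  rw [← h1] at h
  exact (lp_one_hasSum_norm _).unique h

variable [∀ n, NormedSpace 𝕜 (X n)]

/-- The unit ball is generated by the balls of the summands, so some summand already meets the
slice. Norms add across coordinates, so moving in that one suffices. -/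
theorem HasDaugavetProperty.lp_one [∀ n, Nontrivial (X n)]
    (h : ∀ n, HasDaugavetProperty 𝕜 (X n)) : HasDaugavetProperty 𝕜 (lp X 1) := by
  rintro S ⟨f, α, hα, rfl⟩ x hx ε hε
  set s := sSup ((fun y => RCLike.re (f y)) '' Metric.closedBall (0 : lp X 1) 1) with hs
  let f' : ∀ n, StrongDual 𝕜 (X n) := fun n => f ∘L lp.singleContinuousLinearMap 𝕜 X 1 n
  have hf' : ∀ n y, f' n y = f (lp.single 1 n y) := fun n y => rfl
  obtain ⟨n, y₀, hy₀, hlt⟩ : ∃ n, ∃ y ∈ Metric.closedBall (0 : X n) 1,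
      s - α / 2 < RCLike.re (f' n y) := by
    by_contra! hcon
    have h0 : 0 ≤ s - α / 2 := by simpa using hcon 0 0 (by simp)
    have h1 : ∀ n (y : X n), RCLike.re (f' n y) ≤ (s - α / 2) * ‖y‖ := fun n y => by
      rcases eq_or_ne y 0 with rfl | hy
      · simp
      have hpos : 0 < ‖y‖ := norm_pos_iff.2 hy
      have h2 := hcon n (((‖y‖⁻¹ : ℝ) : 𝕜) • y) (by
        rw [mem_closedBall_zero_iff, norm_smul, RCLike.norm_ofReal, abs_of_pos (inv_pos.2 hpos),
          inv_mul_cancel₀ hpos.ne'])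
      rwa [map_smul, smul_eq_mul, RCLike.re_ofReal_mul, inv_mul_le_iff₀ hpos, mul_comm] at h2
    have h2 : s ≤ s - α / 2 := by
      refine csSup_le ⟨_, 0, by simp, rfl⟩ ?_
      rintro _ ⟨y, hy, rfl⟩
      have h3 := ((lp.hasSum_single (p := 1) (by simp) y).mapL f).mapL RCLike.reCLM
      have h4 := hasSum_le (fun n => h1 n (y n)) h3 ((lp_one_hasSum_norm y).mul_left (s - α / 2))
      exact h4.trans (mul_le_of_le_one_right h0 (mem_closedBall_zero_iff.1 hy))
    linarith
  have hxn : ‖x n‖ ≤ 1 := (lp.norm_apply_le_norm (by simp) x n).trans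
    (mem_sphere_zero_iff_norm.1 hx).le
  obtain ⟨y, hy, hxy⟩ := (h n).exists_norm_add_one_lt (𝕜 := 𝕜)
    ⟨f' n, α / 2, half_pos hα, rfl⟩ hxn hε
  have hsup := le_csSup (bddAbove_re_image_closedBall (f' n)) (Set.mem_image_of_mem _ hy₀)
  refine ⟨lp.single 1 n y, ⟨?_, ?_⟩, ?_⟩
  · rw [mem_closedBall_zero_iff, lp.norm_single (by simp)]
    exact mem_closedBall_zero_iff.1 hy.1
  · have := hy.2
    rw [hf'] at this
    linarith
  · rw [lp_one_norm_sub_single, mem_sphere_zero_iff_norm.1 hx]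
    linarith

end Sum

/-! ### Points that are stable under convex combinations -/

section Stable

variable (𝕜 : Type u) [RCLike 𝕜]

/-- If a convex combination of at most `m` points of the unit ball is close to `e`, then the points
are close to `e` on average. -/
def IsStablePoint {X : Type*} [NormedAddCommGroup X] [NormedSpace 𝕜 X] (m : ℕ) (C τ : ℝ)
    (e : X) : Prop :=
  ∀ (ι : Type) [Fintype ι], Fintype.card ι ≤ m → ∀ z : ι → X, (∀ l, ‖z l‖ ≤ 1) →
    ∀ w : ι → ℝ, (∀ l, 0 ≤ w l) → ∑ l, w l = 1 →
      ∑ l, w l * ‖z l - e‖ ≤ C * ‖∑ l, (w l : 𝕜) • z l - e‖ + τ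

variable {𝕜}

/-- Split each midpoint into its endpoints with half the weight, then use the triangle inequality
through `e`. -/
theorem IsStablePoint.sum_mul_norm_sub_le {X : Type*} [NormedAddCommGroup X] [NormedSpace 𝕜 X]
    {m : ℕ} {C τ : ℝ} {e : X} (h : IsStablePoint 𝕜 m C τ e) {ι : Type} [Fintype ι]
    (hι : 2 * Fintype.card ι ≤ m) {x y : ι → X} (hx : ∀ l, ‖x l‖ ≤ 1) (hy : ∀ l, ‖y l‖ ≤ 1)
    {w : ι → ℝ} (hw : ∀ l, 0 ≤ w l) (hw1 : ∑ l, w l = 1) :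
    ∑ l, w l * ‖x l - y l‖ ≤
      2 * (C * ‖∑ l, (w l : 𝕜) • (2⁻¹ : 𝕜) • (x l + y l) - e‖ + τ) := by
  have key := h (ι ⊕ ι) (by rw [Fintype.card_sum]; omega) (Sum.elim x y)
    (by rintro (l | l); exacts [hx l, hy l])
    (Sum.elim (fun l => w l / 2) (fun l => w l / 2))
    (by rintro (l | l) <;> exact div_nonneg (hw l) zero_le_two)
    (by simp [Fintype.sum_sum_type, ← Finset.sum_div, hw1]; norm_num)
  simp only [Fintype.sum_sum_type, Sum.elim_inl, Sum.elim_inr, ← Finset.sum_add_distrib] at key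
  have h1 : ∀ l, ((w l / 2 : ℝ) : 𝕜) • x l + ((w l / 2 : ℝ) : 𝕜) • y l =
      (w l : 𝕜) • (2⁻¹ : 𝕜) • (x l + y l) := fun l => by
    rw [← smul_add, smul_smul]
    congr 1
    push_cast
    rw [div_eq_mul_inv]
  simp_rw [h1] at key
  have h2 : ∑ l, w l * ‖x l - y l‖ ≤ 2 * ∑ l, (w l / 2 * ‖x l - e‖ + w l / 2 * ‖y l - e‖) := by
    rw [Finset.mul_sum]
    refine Finset.sum_le_sum fun l _ => ?_
    have h3 := norm_sub_le_norm_sub_add_norm_sub (x l) e (y l)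
    rw [norm_sub_rev e] at h3
    have := mul_le_mul_of_nonneg_left h3 (hw l)
    linarith
  linarith

theorem IsStablePoint.lp_one_single {X : ℕ → Type*} [∀ n, NormedAddCommGroup (X n)]
    [∀ n, NormedSpace 𝕜 (X n)] {n m : ℕ} {C τ : ℝ} (hC : 0 ≤ C) {e : X n} (he : ‖e‖ = 1)
    (h : IsStablePoint 𝕜 m C τ e) :
    IsStablePoint 𝕜 m (2 * C) (2 * τ) (lp.single 1 n e : lp X 1) := by
  intro ι _ hι z hz w hw hw1
  have hzn : ∀ l, ‖z l n‖ ≤ 1 := fun l => (lp.norm_apply_le_norm (by simp) (z l) n).trans (hz l)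
  have key := h ι hι (fun l => z l n) hzn w hw hw1
  -- The mass of `z l` outside coordinate `n` is at most `1 - ‖z l n‖ ≤ ‖z l n - e‖`, hence the
  -- factor two.
  have h1 : ∀ l, ‖z l - lp.single 1 n e‖ ≤ 2 * ‖z l n - e‖ := fun l => by
    rw [lp_one_norm_sub_single]
    have := norm_sub_norm_le e (z l n)
    rw [he, norm_sub_rev] at this
    linarith [hz l]
  have h2 : ‖∑ l, (w l : 𝕜) • z l n - e‖ ≤ ‖∑ l, (w l : 𝕜) • z l - lp.single 1 n e‖ := by
    have := lp.norm_apply_le_norm (by simp) (∑ l, (w l : 𝕜) • z l - lp.single 1 n e) n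
    rwa [lp.coeFn_sub, Pi.sub_apply, lp.single_apply_self, lp_sum_smul_apply] at this
  calc ∑ l, w l * ‖z l - lp.single 1 n e‖ ≤ 2 * ∑ l, w l * ‖z l n - e‖ := by
        rw [Finset.mul_sum]
        refine Finset.sum_le_sum fun l _ => ?_
        have := mul_le_mul_of_nonneg_left (h1 l) (hw l)
        linarith
    _ ≤ _ := by
        have := mul_le_mul_of_nonneg_left h2 hC
        linarith

theorem IsStablePoint.le_uniformConst {X : Type*} [NormedAddCommGroup X] [NormedSpace 𝕜 X]
    {m n : ℕ} (hn : 2 * n ≤ m) {C τ : ℝ} (hC : 0 < C) {e : X} (he : ‖e‖ = 1)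
    (h : IsStablePoint 𝕜 m C τ e) {α c : ℝ} (hc : 2 * (C * c + τ) ≤ α) :
    ENNReal.ofReal c ≤ uniformConst 𝕜 X n α := by
  refine le_trans ?_ (le_iSup₂ (f := fun x (_ : x ∈ Metric.sphere (0 : X) 1) =>
    Metric.infEDist x (convN 𝕜 n (farMidpoints 𝕜 X α))) e (mem_sphere_zero_iff_norm.2 he))
  rw [Metric.le_infEDist]
  rintro _ ⟨w, p, hw, hw1, hp, rfl⟩
  choose x hx y hy hxy hpxy using hp
  have h1 := h.sum_mul_norm_sub_le (𝕜 := 𝕜) (by simpa using hn)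
    (fun l => mem_closedBall_zero_iff.1 (hx l)) (fun l => mem_closedBall_zero_iff.1 (hy l))
    (fun l => (hw l).1) hw1
  have h2 : α ≤ ∑ l, w l * ‖x l - y l‖ := by
    calc α = ∑ l, w l * α := by rw [← Finset.sum_mul, hw1, one_mul]
      _ ≤ _ := Finset.sum_le_sum fun l _ => mul_le_mul_of_nonneg_left (hxy l) (hw l).1
  simp_rw [hpxy]
  rw [edist_dist, dist_comm, dist_eq_norm]
  refine ENNReal.ofReal_le_ofReal (le_of_mul_le_mul_left ?_ hC)
  linarith

end Stable

/-! ### Ultrapowers -/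

section Ultrapower

variable {𝕜 : Type u} [RCLike 𝕜] {U : Ultrafilter ℕ} {Y : Type*} [NormedAddCommGroup Y]
  [NormedSpace 𝕜 Y]

theorem eventually_norm_lt_of_norm_mk_lt {a : lp (fun _ : ℕ => Y) ∞} {r : ℝ}
    (h : ‖(c0Ultra 𝕜 U fun _ : ℕ => Y).mkQ a‖ < r) : ∀ᶠ n in (U : Filter ℕ), ‖a n‖ < r := by
  obtain ⟨b, hb, hbr⟩ := Submodule.Quotient.norm_mk_lt ((c0Ultra 𝕜 U fun _ : ℕ => Y).mkQ a)
    (sub_pos.2 h)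
  have hmem : a - b ∈ c0Ultra 𝕜 U fun _ : ℕ => Y := (Submodule.Quotient.eq _).1 hb.symm
  have hlim : Tendsto (fun n => ‖(a - b) n‖) (U : Filter ℕ) (𝓝 0) := hmem
  have hbr' : ‖b‖ < r := by linarith
  filter_upwards [hlim.eventually_lt_const (sub_pos.2 hbr')] with n hn
  have h1 := lp.norm_apply_le_norm (by simp) b n
  have h2 : ‖a n‖ ≤ ‖(a - b) n‖ + ‖b n‖ := by
    have := norm_add_le ((a - b) n) (b n)
    simpa using this
  linarith

theorem eventually_lt_norm_of_lt_norm_mk {a : lp (fun _ : ℕ => Y) ∞} {r : ℝ}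
    (h : r < ‖(c0Ultra 𝕜 U fun _ : ℕ => Y).mkQ a‖) : ∀ᶠ n in (U : Filter ℕ), r < ‖a n‖ := by
  classical
  by_contra hcon
  rw [← Ultrafilter.eventually_not] at hcon
  have hcon' : ∀ᶠ n in (U : Filter ℕ), ‖a n‖ ≤ r := hcon.mono fun n hn => not_lt.1 hn
  obtain ⟨n₀, hn₀⟩ := hcon'.exists
  have hr : 0 ≤ r := (norm_nonneg _).trans hn₀
  have hbound : ∀ n, ‖if ‖a n‖ ≤ r then a n else 0‖ ≤ r := fun n => by
    split_ifs with hn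
    · exact hn
    · simpa using hr
  let b : lp (fun _ : ℕ => Y) ∞ := ⟨fun n => if ‖a n‖ ≤ r then a n else 0,
    memℓp_infty ⟨r, by rintro _ ⟨n, rfl⟩; exact hbound n⟩⟩
  have hab : (c0Ultra 𝕜 U fun _ : ℕ => Y).mkQ a = (c0Ultra 𝕜 U fun _ : ℕ => Y).mkQ b := by
    refine (Submodule.Quotient.eq _).2 ?_
    change Tendsto (fun n => ‖(a - b) n‖) (U : Filter ℕ) (𝓝 0)
    refine tendsto_const_nhds.congr' ?_
    filter_upwards [hcon'] with n hn
    have : b n = a n := if_pos hn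
    simp [this]
  have h1 : ‖(c0Ultra 𝕜 U fun _ : ℕ => Y).mkQ b‖ ≤ ‖b‖ := Submodule.Quotient.norm_mk_le _ b
  have h2 : ‖b‖ ≤ r := lp.norm_le_of_forall_le hr hbound
  rw [← hab] at h1
  linarith

/-- Retract a representative radially to the ball in each coordinate; along `U` this changes norms
by an amount tending to zero. -/
theorem exists_lift_closedBall {x : BanachUltrapower 𝕜 U Y} (hx : ‖x‖ ≤ 1) :
    ∃ a : lp (fun _ : ℕ => Y) ∞, (∀ n, ‖a n‖ ≤ 1) ∧ (c0Ultra 𝕜 U fun _ : ℕ => Y).mkQ a = x := by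
  obtain ⟨a, rfl⟩ := (c0Ultra 𝕜 U fun _ : ℕ => Y).mkQ_surjective x
  have hnorm : ∀ n, ‖(((max 1 ‖a n‖)⁻¹ : ℝ) : 𝕜) • a n‖ ≤ 1 := fun n => by
    have h0 : 0 < max 1 ‖a n‖ := lt_max_of_lt_left one_pos
    rw [norm_smul, RCLike.norm_ofReal, abs_of_pos (inv_pos.2 h0), inv_mul_le_iff₀ h0, mul_one]
    exact le_max_right _ _
  refine ⟨⟨fun n => (((max 1 ‖a n‖)⁻¹ : ℝ) : 𝕜) • a n,
    memℓp_infty ⟨1, by rintro _ ⟨n, rfl⟩; exact hnorm n⟩⟩, hnorm, ?_⟩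
  refine (Submodule.Quotient.eq _).2 ?_
  change Tendsto (fun n => ‖(((max 1 ‖a n‖)⁻¹ : ℝ) : 𝕜) • a n - a n‖) (U : Filter ℕ) (𝓝 0)
  rw [Metric.tendsto_nhds]
  intro ε hε
  filter_upwards [eventually_norm_lt_of_norm_mk_lt (𝕜 := 𝕜) (U := U) (a := a) (r := 1 + ε)
    (by linarith)] with n hn
  have h0 : 0 < max 1 ‖a n‖ := lt_max_of_lt_left one_pos
  have h1 : (((max 1 ‖a n‖)⁻¹ : ℝ) : 𝕜) • a n - a n =
      (((max 1 ‖a n‖)⁻¹ - 1 : ℝ) : 𝕜) • a n := by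
    push_cast
    rw [sub_smul, one_smul]
  have h2 : (max 1 ‖a n‖)⁻¹ ≤ 1 := inv_le_one_of_one_le₀ (le_max_left _ _)
  rw [dist_zero_right, norm_norm, h1, norm_smul, RCLike.norm_ofReal, abs_of_nonpos (by linarith)]
  have h3 : max 1 ‖a n‖ - 1 < ε := by
    rcases max_cases 1 ‖a n‖ with h | h <;> linarith [h.1]
  calc -((max 1 ‖a n‖)⁻¹ - 1) * ‖a n‖ ≤ -((max 1 ‖a n‖)⁻¹ - 1) * max 1 ‖a n‖ :=
        mul_le_mul_of_nonneg_left (le_max_right _ _) (by linarith)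
    _ = max 1 ‖a n‖ - 1 := by rw [neg_mul, sub_mul, inv_mul_cancel₀ h0.ne']; ring
    _ < ε := h3

/-- A functional separating a point of the unit ball from the midpoints of far pairs defines a small
slice. -/
theorem exists_slice_diam_le {E : Type*} [NormedAddCommGroup E] [NormedSpace 𝕜 E] {η : ℝ}
    (hη : 0 ≤ η) {e : E} (he : ‖e‖ ≤ 1) {f : StrongDual 𝕜 E} {r : ℝ}
    (hf : ∀ z ∈ farMidpoints 𝕜 E η, RCLike.re (f z) < r) (hr : r < RCLike.re (f e)) :
    ∃ S : Set E, IsSliceOfUnitBall 𝕜 E S ∧ Metric.diam S ≤ η := by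
  set s := sSup ((fun y => RCLike.re (f y)) '' Metric.closedBall (0 : E) 1) with hs
  have hes : RCLike.re (f e) ≤ s := le_csSup (bddAbove_re_image_closedBall f)
    ⟨e, mem_closedBall_zero_iff.2 he, rfl⟩
  refine ⟨_, ⟨f, s - r, by linarith, rfl⟩, Metric.diam_le_of_forall_dist_le hη ?_⟩
  rintro x ⟨hx, hfx⟩ y ⟨hy, hfy⟩
  rw [← hs, sub_sub_cancel] at hfx hfy
  by_contra! hxy
  rw [dist_eq_norm] at hxy
  have h1 := hf _ ⟨x, hx, y, hy, hxy.le, rfl⟩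
  have h2 : f ((2⁻¹ : 𝕜) • (x + y)) = ((2⁻¹ : ℝ) : 𝕜) * (f x + f y) := by
    rw [map_smul, map_add, smul_eq_mul]
    push_cast
    rfl
  rw [h2, RCLike.re_ofReal_mul, map_add] at h1
  linarith

theorem exists_slice_diam_le_of_forall_le {E : Type*} [NormedAddCommGroup E] [NormedSpace 𝕜 E]
    {η : ℝ} (hη : 0 ≤ η) {e : E} (he : ‖e‖ ≤ 1) {c : ℝ} (hc : 0 < c)
    (h : ∀ (ι : Type) [Fintype ι] (w : ι → ℝ) (q : ι → E), (∀ i, 0 ≤ w i) → ∑ i, w i = 1 →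
      (∀ i, q i ∈ farMidpoints 𝕜 E η) → c ≤ ‖∑ i, (w i : 𝕜) • q i - e‖) :
    ∃ S : Set E, IsSliceOfUnitBall 𝕜 E S ∧ Metric.diam S ≤ η := by
  let _ : NormedSpace ℝ E := NormedSpace.restrictScalars ℝ 𝕜 E
  have _ : IsScalarTower ℝ 𝕜 E := RestrictScalars.isScalarTower ℝ 𝕜 E
  have hnot : e ∉ closure (convexHull ℝ (farMidpoints 𝕜 E η)) := by
    intro hmem
    obtain ⟨p, hp, hdist⟩ := Metric.mem_closure_iff.1 hmem c hc
    obtain ⟨ι, _, w, q, hw, hw1, hq, rfl⟩ := mem_convexHull_iff_exists_fintype.1 hp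
    have h1 := h ι w q hw hw1 hq
    rw [dist_comm, dist_eq_norm] at hdist
    simp_rw [RCLike.real_smul_eq_coe_smul (K := 𝕜)] at hdist
    linarith
  obtain ⟨f, r, hfr, hr⟩ := RCLike.geometric_hahn_banach_closed_point (𝕜 := 𝕜)
    (convex_convexHull ℝ _).closure isClosed_closure hnot
  exact exists_slice_diam_le hη he
    (fun z hz => hfr z (subset_closure (subset_convexHull ℝ _ hz))) hr

theorem exists_slice_ultrapower_diam_le {η C τ : ℝ} (hη : 0 < η) (hC : 0 < C) (hτ : 8 * τ ≤ η)
    {e : ℕ → Y} (he : ∀ n, ‖e n‖ = 1) (hstab : ∀ n, IsStablePoint 𝕜 (2 * (n + 1)) C τ (e n))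
    (hU : IsFreeUltrafilter U) :
    ∃ S : Set (BanachUltrapower 𝕜 U Y),
      IsSliceOfUnitBall 𝕜 (BanachUltrapower 𝕜 U Y) S ∧ Metric.diam S ≤ η := by
  let Q := (c0Ultra 𝕜 U fun _ : ℕ => Y).mkQ
  let e' : lp (fun _ : ℕ => Y) ∞ :=
    ⟨e, memℓp_infty ⟨1, by rintro _ ⟨n, rfl⟩; exact (he n).le⟩⟩
  have he' : ‖Q e'‖ ≤ 1 := by
    refine (Submodule.Quotient.norm_mk_le (c0Ultra 𝕜 U fun _ : ℕ => Y) e').trans ?_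
    exact lp.norm_le_of_forall_le zero_le_one fun n => (he n).le
  have hCc : C * (η / (8 * C)) = η / 8 := by field_simp
  -- With this `c`, stability bounds the average gap strictly below `2 (η / 8 + τ) ≤ η / 2`, while
  -- the lifted pairs are more than `η / 2` apart.
  refine exists_slice_diam_le_of_forall_le hη.le he' (c := η / (8 * C)) (by positivity) ?_
  intro ι _ w q hw hw1 hq
  by_contra! hlt
  choose x hx y hy hxy hqxy using hq
  choose a ha hax using fun i => exists_lift_closedBall (mem_closedBall_zero_iff.1 (hx i))
  choose b hb hby using fun i => exists_lift_closedBall (mem_closedBall_zero_iff.1 (hy i))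
  have h1 : ∑ i, (w i : 𝕜) • q i - Q e' =
      Q (∑ i, (w i : 𝕜) • (2⁻¹ : 𝕜) • (a i + b i) - e') := by
    rw [map_sub, map_sum]
    congr 1
    refine Finset.sum_congr rfl fun i _ => ?_
    rw [map_smul, map_smul, map_add, hax, hby, ← hqxy]
  rw [h1] at hlt
  have h2 := eventually_norm_lt_of_norm_mk_lt hlt
  have h3 : ∀ᶠ n in (U : Filter ℕ), ∀ i, η / 2 < ‖(a i - b i) n‖ := by
    refine eventually_all.2 fun i => eventually_lt_norm_of_lt_norm_mk (𝕜 := 𝕜) ?_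
    rw [map_sub, hax, hby]
    linarith [hxy i]
  -- Freeness makes stability at index `n` cover the `2 * card ι` endpoints.
  have h4 : ∀ᶠ n in (U : Filter ℕ), Fintype.card ι ≤ n := by
    refine hU ?_
    rw [Nat.cofinite_eq_atTop]
    exact eventually_ge_atTop _
  obtain ⟨n, h2, h3, h4⟩ := (h2.and (h3.and h4)).exists
  have key := (hstab n).sum_mul_norm_sub_le (𝕜 := 𝕜) (ι := ι) (by omega)
    (fun i => ha i n) (fun i => hb i n) hw hw1
  have h5 : ‖∑ i, (w i : 𝕜) • (2⁻¹ : 𝕜) • (a i n + b i n) - e n‖ < η / (8 * C) := by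
    refine lt_of_eq_of_lt (congrArg _ ?_) h2
    rw [lp.coeFn_sub, Pi.sub_apply, lp_sum_smul_apply]
    rfl
  have h6 : η / 2 ≤ ∑ i, w i * ‖a i n - b i n‖ := by
    calc η / 2 = ∑ i, w i * (η / 2) := by rw [← Finset.sum_mul, hw1, one_mul]
      _ ≤ _ := Finset.sum_le_sum fun i _ => mul_le_mul_of_nonneg_left (h3 i).le (hw i)
  have h7 := mul_lt_mul_of_pos_left h5 hC
  linarith

end Ultrapower

/-! ### Assembling the family -/

theorem AtomTree.isStablePoint_root {𝕜 : Type u} [RCLike 𝕜] (m : ℕ) {τ κ : ℝ} (hτ : 0 ≤ τ)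
    (hκ : 0 ≤ κ) (hτκ : ∀ z : 𝕜, |RCLike.im z| ≤ τ * ‖z‖ + κ * (‖z‖ - RCLike.re z)) :
    IsStablePoint 𝕜 m (5 + κ) τ (AtomTree.atom 𝕜 m AtomTree.root) :=
  fun _ _ hι z hz w hw hw1 => AtomTree.sum_mul_norm_sub_atom_root_le hι hτ hκ hτκ z hz w hw hw1

open AtomTree in
/-- The tree spaces are uniformly stable at the root; their `ℓ¹`-sum has the Daugavet property, but
its ultrapowers have small slices. -/
theorem exists_daugavet_family (𝕜 : Type u) [RCLike 𝕜] {η : ℝ} (hη : 0 < η) :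
      ∃ (X : ℕ → Type u) (_ : ∀ n, NormedAddCommGroup (X n)) (_ : ∀ n, NormedSpace 𝕜 (X n))
        (_ : ∀ n, CompleteSpace (X n)),
        (∀ n, HasDaugavetProperty 𝕜 (X n)) ∧
        (∃ c : ℝ, 0 < c ∧ ∀ n, ENNReal.ofReal c ≤ uniformConst 𝕜 (X n) (n + 1) (2 * (η / 4))) ∧
        ((RCLike.I : 𝕜) = 0 →
          ∀ n, ENNReal.ofReal (η / 4 / 8) ≤ uniformConst 𝕜 (X n) (n + 1) (2 * (η / 4))) ∧
        Nontrivial (lp X 1) ∧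
        CompleteSpace (lp X 1) ∧
        HasDaugavetProperty 𝕜 (lp X 1) ∧
        ∀ U : Ultrafilter ℕ, IsFreeUltrafilter U →
          ∃ S : Set (BanachUltrapower 𝕜 U (lp X 1)),
            IsSliceOfUnitBall 𝕜 (BanachUltrapower 𝕜 U (lp X 1)) S ∧ Metric.diam S ≤ η := by
  have hne : ∀ n, Nontrivial (TreeSpace 𝕜 (2 * (n + 1))) := fun n =>
    ⟨atom 𝕜 _ root, 0, norm_ne_zero_iff.1 (by rw [norm_atom_root]; exact one_ne_zero)⟩
  have hD : ∀ n, HasDaugavetProperty 𝕜 (TreeSpace 𝕜 (2 * (n + 1))) := fun n =>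
    hasDaugavetProperty_treeSpace (by omega)
  have hτ : 0 < η / 16 := by positivity
  have hκ : 0 < (η / 16)⁻¹ := by positivity
  have hst : ∀ n, IsStablePoint 𝕜 (2 * (n + 1)) (5 + (η / 16)⁻¹) (η / 16)
      (atom 𝕜 (2 * (n + 1)) root) := fun n =>
    isStablePoint_root _ hτ.le hκ.le fun z => abs_im_le z hτ
  have hC : 0 < 5 + (η / 16)⁻¹ := by positivity
  -- `m = 2 * (n + 1)` because `n + 1` midpoints have that many endpoints. The error `η / 16`
  -- doubles to `η / 8` in the `ℓ¹`-sum, exactly what the ultrapower argument allows.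
  refine ⟨fun n => TreeSpace 𝕜 (2 * (n + 1)), inferInstance, inferInstance, inferInstance, hD,
    ⟨η / 16 / (5 + (η / 16)⁻¹), by positivity, fun n => ?_⟩, fun hI n => ?_, ?_, inferInstance,
    HasDaugavetProperty.lp_one hD, fun U hU => ?_⟩
  · refine (hst n).le_uniformConst le_rfl hC norm_atom_root ?_
    rw [mul_div_cancel₀ _ hC.ne']
    linarith
  · refine (isStablePoint_root (𝕜 := 𝕜) _ le_rfl le_rfl fun z => ?_).le_uniformConst le_rfl
      (by norm_num) norm_atom_root ?_
    · have : RCLike.im z = 0 := by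
        rw [← RCLike.I_im' z, hI, map_zero, zero_mul]
      simp [this]
    · linarith
  · refine ⟨lp.single 1 0 (atom 𝕜 _ root), 0, norm_ne_zero_iff.1 ?_⟩
    rw [lp.norm_single (by simp), norm_atom_root]
    exact one_ne_zero
  · refine exists_slice_ultrapower_diam_le (e := fun n => lp.single 1 n (atom 𝕜 _ root)) hη
      (mul_pos two_pos hC) (by linarith) (fun n => ?_)
      (fun n => (hst n).lp_one_single hC.le norm_atom_root) hU
    rw [lp.norm_single (by simp), norm_atom_root]

end

theorem mainTheorem4 (𝕜 : Type u) [RCLike 𝕜] :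
    (∀ η : ℝ, 0 < η →
      ∃ (X : ℕ → Type u) (_ : ∀ n, NormedAddCommGroup (X n)) (_ : ∀ n, NormedSpace 𝕜 (X n))
        (_ : ∀ n, CompleteSpace (X n)),
        (∀ n, HasDaugavetProperty 𝕜 (X n)) ∧
        (∃ c : ℝ, 0 < c ∧ ∀ n, ENNReal.ofReal c ≤ uniformConst 𝕜 (X n) (n + 1) (2 * (η / 4))) ∧
        ((RCLike.I : 𝕜) = 0 →
          ∀ n, ENNReal.ofReal (η / 4 / 8) ≤ uniformConst 𝕜 (X n) (n + 1) (2 * (η / 4))) ∧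
        Nontrivial (lp X 1) ∧
        CompleteSpace (lp X 1) ∧
        HasDaugavetProperty 𝕜 (lp X 1) ∧
        ∀ U : Ultrafilter ℕ, IsFreeUltrafilter U →
          ∃ S : Set (BanachUltrapower 𝕜 U (lp X 1)),
            IsSliceOfUnitBall 𝕜 (BanachUltrapower 𝕜 U (lp X 1)) S ∧ Metric.diam S ≤ η) ∧
    (∃ (X : Type u) (_ : NormedAddCommGroup X) (_ : NormedSpace 𝕜 X) (_ : CompleteSpace X),
      HasSliceD2P 𝕜 X ∧
      ∀ U : Ultrafilter ℕ, IsFreeUltrafilter U →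
        ¬ HasSliceD2P 𝕜 (BanachUltrapower 𝕜 U X)) := by
  refine ⟨fun η hη => exists_daugavet_family 𝕜 hη, ?_⟩
  obtain ⟨X, i₁, i₂, i₃, -, -, -, hne, hcomplete, hD, hslice⟩ :=
    exists_daugavet_family 𝕜 (one_pos (α := ℝ))
  refine ⟨lp X 1, inferInstance, inferInstance, hcomplete, hD.hasSliceD2P, fun U hU h => ?_⟩
  obtain ⟨S, hS, hdiam⟩ := hslice U hU
  rw [h S hS] at hdiam
  norm_num at hdiam
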